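/- Let $H_1,H_2,U$ be (real or complex) Hilbert spaces, and let $A_i:\mathcal D(A_i)\subseteq H_i\to H_i$ ($i=1,2$) be positive self-adjoint operators, positivity being strict: $\langle A_ix,x\rangle\ge m_i\|x\|^2$ on $\mathcal D(A_i)$ with $m_i>0$. Put $H_{i,1/2}=\mathcal D(A_i^{1/2})$ with norm $\|A_i^{1/2}x\|$, and let $H_{i,-1/2}$ be its dual with respect to the pivot space $H_i$. Let $B:U\to H_{1,-1/2}$ be bounded, with adjoint $B^*:H_{1,1/2}\to U$. Let $C:\mathcal D(C)\subseteq H_2\to H_1$ be a linear operator such that, with continuous embeddings (the domains on the right carrying the graph norms), $$H_{1,1/2}\hookrightarrow\mathcal D(C^*),\qquad H_{2,1/2}\hookrightarrow\mathcal D(C),$$ and suppose that there is $\delta\in[0,\tfrac12)$ with $$|\langle x,Cy\rangle|\le\delta\left(\|A_1^{1/2}x\|^2+\|y\|^2+\|C^*x\|^2\right)\qquad\text{for all }x\in\mathcal D(A_1),\ y\in\mathcal D(A_2).$$ On the Hilbert space $H=H_1\times H_2$ let $$A\begin{pmatrix}u\\v\end{pmatrix}=\begin{pmatrix}A_1u+C(C^*u+A_2^{1/2}v)\\A_2^{1/2}(C^*u+A_2^{1/2}v)\end{pmatrix},\qquad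 \mathcal D(A)=\{(u,v)\in\mathcal D(A_1)\times H_{2,1/2}:\ C^*u+A_2^{1/2}v\in H_{2,1/2}\},$$ and $\mathcal B_0=\begin{pmatrix}B\\0\end{pmatrix}:U\to\mathcal D(A^{1/2})^*$, so that $\mathcal B_0^*(x,y)=B^*x$. Consider, for $t\ge0$, the three systems (a) $\ddot w_1+A_1w_1+BB^*\dot w_1+C\dot w_2=0$ in $H_{1,-1/2}$ and $\ddot w_2+A_2w_2-C^*\dot w_1=0$ in $H_2$ (with $w_2(t)\in\mathcal D(A_2)$), with energy $$E(t)=\tfrac12\left(\|A_1^{1/2}w_1\|^2+\|A_2^{1/2}w_2\|^2+\|\dot w_1\|^2+\|\dot w_2\|^2\right);$$ (b) $\ddot u+(A_1+CC^*)u+BB^*\dot u+CA_2^{1/2}v=0$ in $H_{1,-1/2}$ and $\ddot v+A_2v+A_2^{1/2}C^*u=0$ in $H_{2,-1/2}$, with energy $$\widetilde E(t)=\tfrac12\left(\|A_1^{1/2}u\|^2+\|A_2^{1/2}v\|^2+\|C^*u\|^2+\|\dot u\|^2+\|\dot v\|^2\right);$$ (c) $\ddot W+AW+\mathcal B_0\mathcal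 B_0^*\dot W=0$ in $\mathcal D(A^{1/2})^*$, with energy $$\mathcal E(t)=\tfrac12\left(\|A^{1/2}W\|^2+\|\dot W\|^2_{H_1\times H_2}\right).$$ Here the operators are extended by duality to the spaces in which the equations are posed. Solutions are the classical ones: $w_1,u\in C^1([0,\infty);H_{1,1/2})\cap C^2([0,\infty);H_1)$, $w_2,v\in C^1([0,\infty);H_{2,1/2})\cap C^2([0,\infty);H_2)$, $W\in C^1([0,\infty);\mathcal D(A^{1/2}))\cap C^2([0,\infty);H)$. A system with energy $\mathsf E$ is called exponentially stable if there are constants $M,\omega>0$ with $\mathsf E(t)\le Me^{-\omega t}\mathsf E(0)$ for all $t\ge0$ and all solutions of the system. Then the exponential stabilities of the three systems (a), (b) and (c) are equivalent. -/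

import Mathlib

open scoped InnerProductSpace

namespace CoupledSystem

noncomputable section

/-! ### Unbounded operators -/

section Operators

variable {𝕜 E F : Type*} [RCLike 𝕜]
  [NormedAddCommGroup E] [InnerProductSpace 𝕜 E]
  [NormedAddCommGroup F] [InnerProductSpace 𝕜 F]

open Classical in
/-- Evaluation of an unbounded operator as a total function. Whenever it is used the point is
in the domain; the value off the domain is the arbitrary value `0`. -/
def app (T : E →ₗ.[𝕜] F) (x : E) : F :=
  if h : x ∈ T.domain then T ⟨x, h⟩ else 0

theorem app_of_mem (T : E →ₗ.[𝕜] F) {x : E} (h : x ∈ T.domain) : app T x = T ⟨x, h⟩ :=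
  dif_pos h

theorem app_add (T : E →ₗ.[𝕜] F) {x y : E} (hx : x ∈ T.domain) (hy : y ∈ T.domain) :
    app T (x + y) = app T x + app T y := by
  rw [app_of_mem T hx, app_of_mem T hy, app_of_mem T (T.domain.add_mem hx hy), ← T.map_add]
  rfl

theorem app_smul (T : E →ₗ.[𝕜] F) (c : 𝕜) {x : E} (hx : x ∈ T.domain) :
    app T (c • x) = c • app T x := by
  rw [app_of_mem T hx, app_of_mem T (T.domain.smul_mem c hx), ← T.map_smul]
  rfl

theorem app_zero (T : E →ₗ.[𝕜] F) : app T 0 = 0 := by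
  rw [app_of_mem T T.domain.zero_mem]
  exact T.map_zero

/-- `A` is a positive self-adjoint operator, positivity being understood strictly:
`⟨A x, x⟩ ≥ m ‖x‖²` for some `m > 0`, so that `A` is boundedly invertible. -/
def IsPositiveSelfAdjoint [CompleteSpace E] (A : E →ₗ.[𝕜] E) : Prop :=
  IsSelfAdjoint A ∧
    ∃ m : ℝ, 0 < m ∧ ∀ x ∈ A.domain, m * ‖x‖ ^ 2 ≤ RCLike.re ⟪app A x, x⟫_𝕜

/-- `S` is a nonnegative self-adjoint operator with `S ∘ S = A`, including equality of the
domains: `D(A) = {x ∈ D(S) | S x ∈ D(S)}`. -/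
def IsNonnegSqrt [CompleteSpace E] (A S : E →ₗ.[𝕜] E) : Prop :=
  IsSelfAdjoint S ∧ (∀ x ∈ S.domain, 0 ≤ RCLike.re ⟪app S x, x⟫_𝕜) ∧
    ∀ x z : E, (x, z) ∈ A.graph ↔ ∃ y : E, (x, y) ∈ S.graph ∧ (y, z) ∈ S.graph

open Classical in
/-- The square root `A^{1/2}`: the unique nonnegative self-adjoint operator whose square is `A`
(it exists for every nonnegative self-adjoint `A`; for all other operators the value is an
arbitrary one). -/
def sqrtOp [CompleteSpace E] (A : E →ₗ.[𝕜] E) : E →ₗ.[𝕜] E :=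
  if h : ∃ S, IsNonnegSqrt A S then h.choose else ⊥

/-- `D(S) ↪ D(T)`: inclusion of the domain of `S`, with the norm `‖S x‖`, in the domain of `T`,
with its graph norm, the inclusion being continuous. -/
def DomainEmbeds {G : Type*} [NormedAddCommGroup G] [InnerProductSpace 𝕜 G]
    (S : E →ₗ.[𝕜] F) (T : E →ₗ.[𝕜] G) : Prop :=
  S.domain ≤ T.domain ∧ ∃ c : ℝ, ∀ x ∈ S.domain, ‖x‖ + ‖app T x‖ ≤ c * ‖app S x‖

end Operators

/-! ### Control operators `U → D(S)*` -/

section Control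

variable {𝕜 E U : Type*} [RCLike 𝕜]
  [NormedAddCommGroup E] [InnerProductSpace 𝕜 E]
  [NormedAddCommGroup U] [InnerProductSpace 𝕜 U]

/-- A bounded linear operator from `U` to the (anti)dual of the space `D(S)` with norm `‖S x‖`.
The functional `toFun u` is the element `B u` of the dual, and `toFun u x` is the duality
pairing of `x` with `B u`; in both the pairing and the inner product of Mathlib the test vector
is the antilinear argument. The pivot space `E` sits in the dual through `h ↦ ⟪·, h⟫`. -/
structure ControlOperator (S : E →ₗ.[𝕜] E) (U : Type*)
    [NormedAddCommGroup U] [InnerProductSpace 𝕜 U] where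
  toFun : U →ₗ[𝕜] S.domain →ₗ⋆[𝕜] 𝕜
  bound : ∃ c : ℝ, ∀ (u : U) (x : S.domain), ‖toFun u x‖ ≤ c * ‖u‖ * ‖S x‖

variable {S : E →ₗ.[𝕜] E}

/-- For `x ∈ D(S)`, the bounded functional `u ↦ (B u)(x)` on `U`. -/
def ControlOperator.functional (B : ControlOperator S U) (x : S.domain) : StrongDual 𝕜 U :=
  LinearMap.mkContinuousOfExistsBound
    { toFun := fun u => B.toFun u x
      map_add' := fun u v => by simp
      map_smul' := fun c u => by simp }
    (by
      obtain ⟨c, hc⟩ := B.bound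
      refine ⟨c * ‖S x‖, fun u => ?_⟩
      have h := hc u x
      rw [mul_right_comm] at h
      exact h)

open Classical in
/-- The duality pairing of `x ∈ D(S)` with `B u`, with the arbitrary value `0` off `D(S)`. -/
def ControlOperator.pair (B : ControlOperator S U) (u : U) (x : E) : 𝕜 :=
  if h : x ∈ S.domain then B.toFun u ⟨x, h⟩ else 0

open Classical in
/-- The adjoint `B* : D(S) → U`, i.e. `⟪B* x, u⟫ = (B u)(x)` for all `u`, with the arbitrary
value `0` off `D(S)`. -/
def ControlOperator.adj [CompleteSpace U] (B : ControlOperator S U) (x : E) : U :=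
  if h : x ∈ S.domain then (InnerProductSpace.toDual 𝕜 U).symm (B.functional ⟨x, h⟩) else 0

theorem ControlOperator.inner_adj [CompleteSpace U] (B : ControlOperator S U) {x : E}
    (hx : x ∈ S.domain) (u : U) : ⟪B.adj x, u⟫_𝕜 = B.pair u x := by
  rw [ControlOperator.adj, ControlOperator.pair, dif_pos hx, dif_pos hx,
    InnerProductSpace.toDual_symm_apply]
  rfl

end Control

/-! ### Time regularity on `[0, ∞)` -/

section Time

variable (𝕜 : Type*) {E : Type*} [RCLike 𝕜] [NormedAddCommGroup E] [InnerProductSpace 𝕜 E]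

/-- `f' t` is the derivative of `f` at `t` for every `t ≥ 0` (one-sided at `0`), and `f'` is
continuous on `[0, ∞)`. -/
def IsC1 (f f' : ℝ → E) : Prop :=
  letI : NormedSpace ℝ E := NormedSpace.restrictScalars ℝ 𝕜 E
  (∀ t : ℝ, 0 ≤ t → HasDerivWithinAt f (f' t) (Set.Ici 0) t) ∧ ContinuousOn f' (Set.Ici 0)

variable {𝕜}

/-- `w ∈ C¹([0, ∞); D(S)) ∩ C²([0, ∞); E)` with time derivatives `w'` and `w''`, where `D(S)`
carries the norm `‖S x‖`. -/
structure IsTrajectory (S : E →ₗ.[𝕜] E) (w w' w'' : ℝ → E) : Prop where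
  mem : ∀ t : ℝ, 0 ≤ t → w t ∈ S.domain
  mem_deriv : ∀ t : ℝ, 0 ≤ t → w' t ∈ S.domain
  c1_domain : IsC1 𝕜 (fun t => app S (w t)) (fun t => app S (w' t))
  c1 : IsC1 𝕜 w w'
  c2 : IsC1 𝕜 w' w''

end Time

/-! ### The three systems -/

section Systems

variable {𝕜 H₁ H₂ U : Type*} [RCLike 𝕜]
  [NormedAddCommGroup H₁] [InnerProductSpace 𝕜 H₁] [CompleteSpace H₁]
  [NormedAddCommGroup H₂] [InnerProductSpace 𝕜 H₂] [CompleteSpace H₂]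
  [NormedAddCommGroup U] [InnerProductSpace 𝕜 U] [CompleteSpace U]

/-- Solutions of
`w₁'' + A₁ w₁ + B B* w₁' + C w₂' = 0` (an equation in `D(A₁^{1/2})*`, hence tested with all
`x ∈ D(A₁^{1/2})`; there `A₁ w` is the functional `x ↦ ⟪A₁^{1/2} x, A₁^{1/2} w⟫`), and
`w₂'' + A₂ w₂ - C* w₁' = 0` (an equation in `H₂`). -/
structure IsSolutionW (A₁ : H₁ →ₗ.[𝕜] H₁) (A₂ : H₂ →ₗ.[𝕜] H₂)
    (B : ControlOperator (sqrtOp A₁) U) (C : H₂ →ₗ.[𝕜] H₁)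
    (w₁ w₁' w₁'' : ℝ → H₁) (w₂ w₂' w₂'' : ℝ → H₂) : Prop where
  traj₁ : IsTrajectory (sqrtOp A₁) w₁ w₁' w₁''
  traj₂ : IsTrajectory (sqrtOp A₂) w₂ w₂' w₂''
  eq₁ : ∀ t : ℝ, 0 ≤ t → ∀ x ∈ (sqrtOp A₁).domain,
    ⟪x, w₁'' t⟫_𝕜 + ⟪app (sqrtOp A₁) x, app (sqrtOp A₁) (w₁ t)⟫_𝕜
      + B.pair (B.adj (w₁' t)) x + ⟪x, app C (w₂' t)⟫_𝕜 = 0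
  mem₂ : ∀ t : ℝ, 0 ≤ t → w₂ t ∈ A₂.domain
  eq₂ : ∀ t : ℝ, 0 ≤ t → w₂'' t + app A₂ (w₂ t) - app C.adjoint (w₁' t) = 0

/-- Solutions of
`u'' + (A₁ + C C*) u + B B* u' + C A₂^{1/2} v = 0` in `D(A₁^{1/2})*`, and
`v'' + A₂ v + A₂^{1/2} C* u = 0` in `D(A₂^{1/2})*`.
Here `C h`, for `h ∈ H₂`, is the functional `x ↦ ⟪C* x, h⟫` on `D(A₁^{1/2})`, and
`A₂^{1/2} h` is the functional `y ↦ ⟪A₂^{1/2} y, h⟫` on `D(A₂^{1/2})`. -/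
structure IsSolutionUV (A₁ : H₁ →ₗ.[𝕜] H₁) (A₂ : H₂ →ₗ.[𝕜] H₂)
    (B : ControlOperator (sqrtOp A₁) U) (C : H₂ →ₗ.[𝕜] H₁)
    (u u' u'' : ℝ → H₁) (v v' v'' : ℝ → H₂) : Prop where
  traj₁ : IsTrajectory (sqrtOp A₁) u u' u''
  traj₂ : IsTrajectory (sqrtOp A₂) v v' v''
  eq₁ : ∀ t : ℝ, 0 ≤ t → ∀ x ∈ (sqrtOp A₁).domain,
    ⟪x, u'' t⟫_𝕜
      + (⟪app (sqrtOp A₁) x, app (sqrtOp A₁) (u t)⟫_𝕜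
        + ⟪app C.adjoint x, app C.adjoint (u t)⟫_𝕜)
      + B.pair (B.adj (u' t)) x
      + ⟪app C.adjoint x, app (sqrtOp A₂) (v t)⟫_𝕜 = 0
  eq₂ : ∀ t : ℝ, 0 ≤ t → ∀ y ∈ (sqrtOp A₂).domain,
    ⟪y, v'' t⟫_𝕜 + ⟪app (sqrtOp A₂) y, app (sqrtOp A₂) (v t)⟫_𝕜
      + ⟪app (sqrtOp A₂) y, app C.adjoint (u t)⟫_𝕜 = 0

/-- The vector `C* u + A₂^{1/2} v`. -/
def couple (A₂ : H₂ →ₗ.[𝕜] H₂) (C : H₂ →ₗ.[𝕜] H₁) (p : WithLp 2 (H₁ × H₂)) : H₂ :=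
  app C.adjoint p.fst + app (sqrtOp A₂) p.snd

/-- The domain `{(u, v) ∈ D(A₁) × D(A₂^{1/2}) | C* u + A₂^{1/2} v ∈ D(A₂^{1/2})}`. The two
memberships in `D(C*)` and `D(C)` are automatic as soon as `D(A₁^{1/2}) ⊆ D(C*)` and
`D(A₂^{1/2}) ⊆ D(C)`. -/
def matrixDomain (A₁ : H₁ →ₗ.[𝕜] H₁) (A₂ : H₂ →ₗ.[𝕜] H₂) (C : H₂ →ₗ.[𝕜] H₁) :
    Submodule 𝕜 (WithLp 2 (H₁ × H₂)) where
  carrier := {p | p.fst ∈ A₁.domain ∧ p.fst ∈ C.adjoint.domain ∧ p.snd ∈ (sqrtOp A₂).domain ∧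
    couple A₂ C p ∈ (sqrtOp A₂).domain ∧ couple A₂ C p ∈ C.domain}
  add_mem' := by
    rintro p q ⟨h1, h2, h3, h4, h5⟩ ⟨k1, k2, k3, k4, k5⟩
    have e : couple A₂ C (p + q) = couple A₂ C p + couple A₂ C q := by
      simp only [couple, WithLp.add_fst, WithLp.add_snd]
      rw [app_add _ h2 k2, app_add _ h3 k3]
      abel
    refine ⟨add_mem h1 k1, add_mem h2 k2, add_mem h3 k3, ?_, ?_⟩
    · rw [e]; exact add_mem h4 k4
    · rw [e]; exact add_mem h5 k5
  zero_mem' := by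
    have e : couple A₂ C (0 : WithLp 2 (H₁ × H₂)) = 0 := by
      simp [couple, app_zero]
    refine ⟨zero_mem _, zero_mem _, zero_mem _, ?_, ?_⟩ <;> · rw [e]; exact zero_mem _
  smul_mem' := by
    rintro c p ⟨h1, h2, h3, h4, h5⟩
    have e : couple A₂ C (c • p) = c • couple A₂ C p := by
      simp only [couple, WithLp.smul_fst, WithLp.smul_snd]
      rw [app_smul _ c h2, app_smul _ c h3, smul_add]
    refine ⟨Submodule.smul_mem _ c h1, Submodule.smul_mem _ c h2, Submodule.smul_mem _ c h3, ?_, ?_⟩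
    · rw [e]; exact Submodule.smul_mem _ c h4
    · rw [e]; exact Submodule.smul_mem _ c h5

/-- The operator `A (u, v) = (A₁ u + C (C* u + A₂^{1/2} v), A₂^{1/2} (C* u + A₂^{1/2} v))` in the
Hilbert space `H₁ × H₂`. -/
def matrixOp (A₁ : H₁ →ₗ.[𝕜] H₁) (A₂ : H₂ →ₗ.[𝕜] H₂) (C : H₂ →ₗ.[𝕜] H₁) :
    WithLp 2 (H₁ × H₂) →ₗ.[𝕜] WithLp 2 (H₁ × H₂) where
  domain := matrixDomain A₁ A₂ C
  toFun :=
    { toFun := fun p => WithLp.toLp 2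
        (app A₁ p.1.fst + app C (couple A₂ C p.1), app (sqrtOp A₂) (couple A₂ C p.1))
      map_add' := by
        rintro ⟨p, h1, h2, h3, h4, h5⟩ ⟨q, k1, k2, k3, k4, k5⟩
        have e : couple A₂ C (p + q) = couple A₂ C p + couple A₂ C q := by
          simp only [couple, WithLp.add_fst, WithLp.add_snd]
          rw [app_add _ h2 k2, app_add _ h3 k3]
          abel
        simp only [Submodule.coe_add, WithLp.add_fst]
        rw [e, app_add _ h1 k1, app_add _ h5 k5, app_add _ h4 k4, ← WithLp.toLp_add,
          Prod.mk_add_mk, add_add_add_comm]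
      map_smul' := by
        rintro c ⟨p, h1, h2, h3, h4, h5⟩
        have e : couple A₂ C (c • p) = c • couple A₂ C p := by
          simp only [couple, WithLp.smul_fst, WithLp.smul_snd]
          rw [app_smul _ c h2, app_smul _ c h3, smul_add]
        change WithLp.toLp 2 (app A₁ (c • p.fst) + app C (couple A₂ C (c • p)),
          app (sqrtOp A₂) (couple A₂ C (c • p))) = c • WithLp.toLp 2
            (app A₁ p.fst + app C (couple A₂ C p), app (sqrtOp A₂) (couple A₂ C p))
        rw [e, app_smul _ c h1, app_smul _ c h5, app_smul _ c h4, ← WithLp.toLp_smul,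
          Prod.smul_mk, smul_add] }

/-- Solutions of `W'' + A W + 𝓑₀ 𝓑₀* W' = 0` in `D(A^{1/2})*`, where `A` is the operator
`matrixOp`, `𝓑₀ u` is the functional `(x, y) ↦ (B u)(x)` on `D(A^{1/2})`, and `𝓑₀* (x, y) = B* x`
(every `(x, y) ∈ D(A^{1/2})` has `x ∈ D(A₁^{1/2})`). -/
structure IsSolutionAbstract (A₁ : H₁ →ₗ.[𝕜] H₁) (A₂ : H₂ →ₗ.[𝕜] H₂)
    (B : ControlOperator (sqrtOp A₁) U) (C : H₂ →ₗ.[𝕜] H₁)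
    (W W' W'' : ℝ → WithLp 2 (H₁ × H₂)) : Prop where
  traj : IsTrajectory (sqrtOp (matrixOp A₁ A₂ C)) W W' W''
  eq : ∀ t : ℝ, 0 ≤ t → ∀ Z ∈ (sqrtOp (matrixOp A₁ A₂ C)).domain,
    ⟪Z, W'' t⟫_𝕜
      + ⟪app (sqrtOp (matrixOp A₁ A₂ C)) Z, app (sqrtOp (matrixOp A₁ A₂ C)) (W t)⟫_𝕜
      + B.pair (B.adj (W' t).fst) Z.fst = 0

/-! ### Energies and exponential stability -/

/-- The energy `½ (‖A₁^{1/2} w₁‖² + ‖A₂^{1/2} w₂‖² + ‖w₁'‖² + ‖w₂'‖²)`. -/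
def energyW (A₁ : H₁ →ₗ.[𝕜] H₁) (A₂ : H₂ →ₗ.[𝕜] H₂)
    (w₁ w₁' : ℝ → H₁) (w₂ w₂' : ℝ → H₂) (t : ℝ) : ℝ :=
  1 / 2 * (‖app (sqrtOp A₁) (w₁ t)‖ ^ 2 + ‖app (sqrtOp A₂) (w₂ t)‖ ^ 2
    + (‖w₁' t‖ ^ 2 + ‖w₂' t‖ ^ 2))

/-- The energy `½ (‖A₁^{1/2} u‖² + ‖A₂^{1/2} v‖² + ‖C* u‖² + ‖u'‖² + ‖v'‖²)`. -/
def energyUV (A₁ : H₁ →ₗ.[𝕜] H₁) (A₂ : H₂ →ₗ.[𝕜] H₂) (C : H₂ →ₗ.[𝕜] H₁)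
    (u u' : ℝ → H₁) (v v' : ℝ → H₂) (t : ℝ) : ℝ :=
  1 / 2 * (‖app (sqrtOp A₁) (u t)‖ ^ 2 + ‖app (sqrtOp A₂) (v t)‖ ^ 2
    + ‖app C.adjoint (u t)‖ ^ 2 + (‖u' t‖ ^ 2 + ‖v' t‖ ^ 2))

/-- The energy `½ (‖A^{1/2} W‖² + ‖W'‖²)`. -/
def energyAbstract (A₁ : H₁ →ₗ.[𝕜] H₁) (A₂ : H₂ →ₗ.[𝕜] H₂) (C : H₂ →ₗ.[𝕜] H₁)
    (W W' : ℝ → WithLp 2 (H₁ × H₂)) (t : ℝ) : ℝ :=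
  1 / 2 * (‖app (sqrtOp (matrixOp A₁ A₂ C)) (W t)‖ ^ 2 + ‖W' t‖ ^ 2)

/-- Exponential stability of the coupled system in `(w₁, w₂)`. -/
def ExpStableW (A₁ : H₁ →ₗ.[𝕜] H₁) (A₂ : H₂ →ₗ.[𝕜] H₂)
    (B : ControlOperator (sqrtOp A₁) U) (C : H₂ →ₗ.[𝕜] H₁) : Prop :=
  ∃ M ω : ℝ, 0 < M ∧ 0 < ω ∧ ∀ (w₁ w₁' w₁'' : ℝ → H₁) (w₂ w₂' w₂'' : ℝ → H₂),
    IsSolutionW A₁ A₂ B C w₁ w₁' w₁'' w₂ w₂' w₂'' → ∀ t : ℝ, 0 ≤ t →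
      energyW A₁ A₂ w₁ w₁' w₂ w₂' t ≤ M * Real.exp (-ω * t) * energyW A₁ A₂ w₁ w₁' w₂ w₂' 0

/-- Exponential stability of the transformed system in `(u, v)`. -/
def ExpStableUV (A₁ : H₁ →ₗ.[𝕜] H₁) (A₂ : H₂ →ₗ.[𝕜] H₂)
    (B : ControlOperator (sqrtOp A₁) U) (C : H₂ →ₗ.[𝕜] H₁) : Prop :=
  ∃ M ω : ℝ, 0 < M ∧ 0 < ω ∧ ∀ (u u' u'' : ℝ → H₁) (v v' v'' : ℝ → H₂),
    IsSolutionUV A₁ A₂ B C u u' u'' v v' v'' → ∀ t : ℝ, 0 ≤ t →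
      energyUV A₁ A₂ C u u' v v' t ≤ M * Real.exp (-ω * t) * energyUV A₁ A₂ C u u' v v' 0

/-- Exponential stability of the second order equation in `H₁ × H₂`. -/
def ExpStableAbstract (A₁ : H₁ →ₗ.[𝕜] H₁) (A₂ : H₂ →ₗ.[𝕜] H₂)
    (B : ControlOperator (sqrtOp A₁) U) (C : H₂ →ₗ.[𝕜] H₁) : Prop :=
  ∃ M ω : ℝ, 0 < M ∧ 0 < ω ∧ ∀ W W' W'' : ℝ → WithLp 2 (H₁ × H₂),
    IsSolutionAbstract A₁ A₂ B C W W' W'' → ∀ t : ℝ, 0 ≤ t →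
      energyAbstract A₁ A₂ C W W' t ≤ M * Real.exp (-ω * t) * energyAbstract A₁ A₂ C W W' 0

end Systems

end

end CoupledSystem

/-! The three systems are the same dynamics in different variables. Let `T (u, v) = (A₁^{1/2} u, C*
u + A₂^{1/2} v)` on `D(A₁^{1/2}) × D(A₂^{1/2})`. The operator matrix is `A = T* T`, so by polar
decomposition `A^{1/2} = V T` with `V` unitary. Hence the weak form of (c) is the sum of the two
weak equations of (b), and the solutions of (b) and (c) coincide (`isSolutionAbstract_iff`). The
systems (a) and (b) are exchanged by `w₁ = u`, `w₂ = -A₂^{-1/2} v'`, for which `w₂' = C* u +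
A₂^{1/2} v` (`isSolutionW_of_isSolutionUV`, `isSolutionUV_of_isSolutionW`).

Under these identifications the energies of (a) and (c) both equal `energyCoupled`. It is equivalent
to the energy of (b) because `K = C* A₁^{-1/2}` is bounded, so exponential decay passes between the
systems.

Unbounded operators are handled through their bounded inverses: `T⁻¹` is `R = energyInverse P₁ P₂
K`, and `A⁻¹ = R R*` (`isBoundedInverse_matrixOp`). As `sqrtOp` is a choice among square roots, a
root must first be shown to exist; it is the inverse of the square root of the bounded positive
inverse. Only the defining properties of a root are used, never its uniqueness. -/

namespace CoupledSystem

/-! ### Square roots of bounded positive operators, over real or complex scalars. -/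

section BoundedSquareRoot

/-- The scalar majorant of the iteration `Y ↦ (X + Y ^ 2) / 2`. -/
noncomputable def sqrtMajorant : ℕ → ℝ
  | 0 => 0
  | n + 1 => 2⁻¹ * (1 + sqrtMajorant n ^ 2)

theorem sqrtMajorant_mem (n : ℕ) : 0 ≤ sqrtMajorant n ∧ sqrtMajorant n ≤ 1 := by
  induction n with
  | zero => simp [sqrtMajorant]
  | succ n ih => rw [sqrtMajorant]; constructor <;> nlinarith [ih.1, ih.2]

theorem sqrtMajorant_le_succ (n : ℕ) : sqrtMajorant n ≤ sqrtMajorant (n + 1) := by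
  rw [sqrtMajorant]; nlinarith [sq_nonneg (1 - sqrtMajorant n)]

theorem summable_sqrtMajorant_sub :
    Summable fun n => sqrtMajorant (n + 1) - sqrtMajorant n := by
  refine summable_of_sum_range_le (c := 1) (fun n => sub_nonneg.2 (sqrtMajorant_le_succ n))
    fun n => ?_
  rw [Finset.sum_range_sub]
  have := (sqrtMajorant_mem n).2
  simpa [sqrtMajorant] using this

variable {R : Type*} [NormedRing R] [NormedAlgebra ℝ R]

/-- The iteration `Y ↦ (X + Y ^ 2) / 2` started at `0`, which tends to `1 - √(1 - X)`. -/
noncomputable def sqrtIter (X : R) : ℕ → R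
  | 0 => 0
  | n + 1 => (2⁻¹ : ℝ) • (X + sqrtIter X n * sqrtIter X n)

theorem norm_sqrtIter_le {X : R} (hX : ‖X‖ ≤ 1) (n : ℕ) : ‖sqrtIter X n‖ ≤ sqrtMajorant n := by
  induction n with
  | zero => simp [sqrtIter, sqrtMajorant]
  | succ n ih =>
    rw [sqrtIter, sqrtMajorant, norm_smul, Real.norm_of_nonneg (by norm_num), sq]
    gcongr
    refine (norm_add_le _ _).trans (add_le_add hX ((norm_mul_le _ _).trans ?_))
    gcongr
    exact (sqrtMajorant_mem n).1

/-- The identity `a² - b² = a (a - b) + (a - b) b` needs no commutativity and holds for both the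
iterates and their majorant, so the increments of the latter, which are summable, dominate. -/
theorem norm_sqrtIter_sub_le {X : R} (hX : ‖X‖ ≤ 1) (n : ℕ) :
    ‖sqrtIter X (n + 1) - sqrtIter X n‖ ≤ sqrtMajorant (n + 1) - sqrtMajorant n := by
  induction n with
  | zero =>
    simp only [sqrtIter, sqrtMajorant, norm_smul, mul_zero, add_zero, sub_zero]
    norm_num
    exact hX
  | succ n ih =>
    have e : sqrtIter X (n + 2) - sqrtIter X (n + 1) = (2⁻¹ : ℝ) •
        (sqrtIter X (n + 1) * (sqrtIter X (n + 1) - sqrtIter X n)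
          + (sqrtIter X (n + 1) - sqrtIter X n) * sqrtIter X n) := by
      rw [sqrtIter, sqrtIter.eq_2 X n, ← smul_sub, ← sqrtIter.eq_2 X n]
      congr 1
      noncomm_ring
    have e' : sqrtMajorant (n + 2) - sqrtMajorant (n + 1) = 2⁻¹ *
        (sqrtMajorant (n + 1) * (sqrtMajorant (n + 1) - sqrtMajorant n)
          + (sqrtMajorant (n + 1) - sqrtMajorant n) * sqrtMajorant n) := by
      have e1 := sqrtMajorant.eq_2 (n + 1)
      have e2 := sqrtMajorant.eq_2 n
      simp only [Nat.succ_eq_add_one, add_assoc, Nat.reduceAdd] at e1 e2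
      linear_combination e1 - e2
    rw [e, e', norm_smul, Real.norm_of_nonneg (by norm_num)]
    have h0 := sub_nonneg.2 (sqrtMajorant_le_succ n)
    have h1 := (sqrtMajorant_mem (n + 1)).1
    gcongr
    refine (norm_add_le _ _).trans (add_le_add ((norm_mul_le _ _).trans ?_)
      ((norm_mul_le _ _).trans ?_))
    · gcongr
      exact norm_sqrtIter_le hX _
    · gcongr
      exact norm_sqrtIter_le hX _

/-- The limit satisfies `2 Y = X + Y²`, which is `(1 - Y)² = 1 - X`. -/
theorem exists_tendsto_sqrtIter [CompleteSpace R] {X : R} (hX : ‖X‖ ≤ 1) :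
    ∃ Y : R, Filter.Tendsto (sqrtIter X) Filter.atTop (nhds Y) ∧ ‖Y‖ ≤ 1 ∧
      (1 - Y) * (1 - Y) = 1 - X := by
  have hs : CauchySeq (sqrtIter X) := by
    refine cauchySeq_of_dist_le_of_summable _ (fun n => ?_) summable_sqrtMajorant_sub
    rw [dist_comm, dist_eq_norm]
    exact norm_sqrtIter_sub_le hX n
  obtain ⟨Y, hY⟩ := cauchySeq_tendsto_of_complete hs
  refine ⟨Y, hY, ?_, ?_⟩
  · exact le_of_tendsto hY.norm (Filter.Eventually.of_forall fun n =>
      (norm_sqrtIter_le hX n).trans (sqrtMajorant_mem n).2)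
  · have h1 := (Filter.tendsto_add_atTop_iff_nat 1).2 hY
    have h2 : Filter.Tendsto (fun n => sqrtIter X (n + 1)) Filter.atTop
        (nhds ((2⁻¹ : ℝ) • (X + Y * Y))) :=
      (tendsto_const_nhds.add (hY.mul hY)).const_smul _
    have h3 : (2 : ℝ) • Y = X + Y * Y := by
      conv_lhs => rw [tendsto_nhds_unique h1 h2, smul_smul]
      norm_num
    rw [two_smul] at h3
    have : X = Y + Y - Y * Y := by rw [h3]; abel
    rw [this]; noncomm_ring

variable {𝕜 E : Type*} [RCLike 𝕜] [NormedAddCommGroup E] [InnerProductSpace 𝕜 E]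

/-- Positivity at `x - Q x` reads `0 ≤ ⟪Q x, x⟫ - 2 ‖Q x‖² + ⟪Q (Q x), Q x⟫`, and the last term is
at most `‖Q x‖²`. -/
theorem norm_sq_le_re_inner_of_isPositive {Q : E →L[𝕜] E} (hQ : Q.IsPositive) (h1 : ‖Q‖ ≤ 1)
    (x : E) : ‖Q x‖ ^ 2 ≤ RCLike.re ⟪Q x, x⟫_𝕜 := by
  have h := hQ.re_inner_nonneg_left (x - Q x)
  have e1 : ⟪Q (Q x), x⟫_𝕜 = ⟪Q x, Q x⟫_𝕜 := hQ.inner_left_eq_inner_right _ _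
  have e2 : RCLike.re ⟪Q (Q x), Q x⟫_𝕜 ≤ ‖Q x‖ ^ 2 := by
    refine (re_inner_le_norm _ _).trans ?_
    have := Q.le_of_opNorm_le h1 (Q x)
    nlinarith [norm_nonneg (Q x)]
  rw [map_sub, inner_sub_left, inner_sub_right, inner_sub_right, e1] at h
  simp only [map_sub, inner_self_eq_norm_sq] at h
  linarith

theorem norm_one_sub_le_of_isPositive {Q : E →L[𝕜] E} (hQ : Q.IsPositive) (h1 : ‖Q‖ ≤ 1) :
    ‖1 - Q‖ ≤ 1 := by
  refine ContinuousLinearMap.opNorm_le_bound _ zero_le_one fun x => ?_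
  have h := norm_sq_le_re_inner_of_isPositive hQ h1 x
  have h0 := sq_nonneg ‖Q x‖
  have e := @norm_sub_sq 𝕜 _ _ _ _ x (Q x)
  rw [inner_re_symm] at e
  rw [one_mul]
  change ‖x - Q x‖ ≤ ‖x‖
  refine le_of_sq_le_sq ?_ (norm_nonneg _)
  linarith

variable [CompleteSpace E]

/-- The iteration is run with `X = 1 - Q`. Self-adjointness passes to the limit `Y`, and `‖Y‖ ≤ 1`
makes `1 - Y` positive. -/
theorem exists_isPositive_sq_of_norm_le_one {Q : E →L[𝕜] E} (hQ : Q.IsPositive) (h1 : ‖Q‖ ≤ 1) :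
    ∃ P : E →L[𝕜] E, P.IsPositive ∧ P * P = Q := by
  let : NormedAlgebra ℝ (E →L[𝕜] E) := NormedAlgebra.restrictScalars ℝ 𝕜 _
  have hsm : ∀ (c : ℝ) (T : E →L[𝕜] E), c • T = (c : 𝕜) • T := fun c T => by
    rw [← algebraMap_smul 𝕜 c T, RCLike.algebraMap_eq_ofReal]
  obtain ⟨Y, hY, hY1, hYs⟩ := exists_tendsto_sqrtIter (norm_one_sub_le_of_isPositive hQ h1)
  have hsa : ∀ n, IsSelfAdjoint (sqrtIter (1 - Q) n) := by
    intro n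
    induction n with
    | zero => exact IsSelfAdjoint.zero _
    | succ n ih =>
      rw [sqrtIter, hsm]
      refine IsSelfAdjoint.smul (by simp [isSelfAdjoint_iff]) (IsSelfAdjoint.add ?_ ?_)
      · exact (IsSelfAdjoint.one _).sub hQ.isSelfAdjoint
      · exact ih.commute_iff ih |>.1 rfl
  have hYsa : IsSelfAdjoint Y :=
    (isClosed_eq continuous_star continuous_id).mem_of_tendsto hY
      (Filter.Eventually.of_forall fun n => hsa n)
  refine ⟨1 - Y, ?_, by rw [hYs]; abel⟩
  rw [ContinuousLinearMap.isPositive_def']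
  refine ⟨(IsSelfAdjoint.one _).sub hYsa, fun x => ?_⟩
  have e : (1 - Y).reApplyInnerSelf x = ‖x‖ ^ 2 - RCLike.re ⟪Y x, x⟫_𝕜 := by
    rw [ContinuousLinearMap.reApplyInnerSelf_apply]
    change RCLike.re ⟪x - Y x, x⟫_𝕜 = _
    rw [inner_sub_left, map_sub, inner_self_eq_norm_sq]
  rw [e]
  have h2 := re_inner_le_norm (𝕜 := 𝕜) (Y x) x
  have h3 := Y.le_of_opNorm_le hY1 x
  nlinarith [norm_nonneg x]

/-- Every bounded positive operator on a real or complex Hilbert space has a positive square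
root. -/
theorem exists_isPositive_sq {Q : E →L[𝕜] E} (hQ : Q.IsPositive) :
    ∃ P : E →L[𝕜] E, P.IsPositive ∧ P * P = Q := by
  by_cases h0 : Q = 0
  · exact ⟨0, ContinuousLinearMap.isPositive_zero, by simp [h0]⟩
  have hn : 0 < ‖Q‖ := norm_pos_iff.2 h0
  obtain ⟨P, hP, hPP⟩ := exists_isPositive_sq_of_norm_le_one (Q := ((‖Q‖⁻¹ : ℝ) : 𝕜) • Q)
    (hQ.smul_of_nonneg (by rw [RCLike.ofReal_nonneg]; positivity)) (by
      rw [norm_smul, RCLike.norm_ofReal, abs_of_pos (inv_pos.2 hn), inv_mul_cancel₀ hn.ne'])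
  refine ⟨((√‖Q‖ : ℝ) : 𝕜) • P,
    hP.smul_of_nonneg (by rw [RCLike.ofReal_nonneg]; positivity), ?_⟩
  rw [smul_mul_smul_comm, hPP, smul_smul, ← RCLike.ofReal_mul, ← RCLike.ofReal_mul,
    Real.mul_self_sqrt hn.le, mul_inv_cancel₀ hn.ne', RCLike.ofReal_one, one_smul]

end BoundedSquareRoot

/-! ### Unbounded operators and their square roots through bounded inverses. -/

section BoundedInverse

variable {𝕜 E F : Type*} [RCLike 𝕜]
  [NormedAddCommGroup E] [InnerProductSpace 𝕜 E]
  [NormedAddCommGroup F] [InnerProductSpace 𝕜 F]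

theorem mem_graph_iff_app (T : E →ₗ.[𝕜] F) {x : E} {z : F} :
    (x, z) ∈ T.graph ↔ x ∈ T.domain ∧ app T x = z := by
  rw [LinearPMap.mem_graph_iff]
  constructor
  · rintro ⟨y, hy, hz⟩
    dsimp only at hy hz
    subst hy hz
    exact ⟨y.2, app_of_mem T y.2⟩
  · rintro ⟨hx, rfl⟩
    exact ⟨⟨x, hx⟩, rfl, (app_of_mem T hx).symm⟩

/-- The bounded operator `P` is the inverse of the unbounded operator `T`. -/
def IsBoundedInverse (T : E →ₗ.[𝕜] F) (P : F →L[𝕜] E) : Prop :=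
  ∀ x z, (x, z) ∈ T.graph ↔ P z = x

namespace IsBoundedInverse

variable {T : E →ₗ.[𝕜] F} {P : F →L[𝕜] E} (h : IsBoundedInverse T P)
include h

theorem apply_mem (z : F) : P z ∈ T.domain :=
  ((mem_graph_iff_app T).1 ((h _ z).2 rfl)).1

theorem app_apply (z : F) : app T (P z) = z :=
  ((mem_graph_iff_app T).1 ((h _ z).2 rfl)).2

theorem apply_app {x : E} (hx : x ∈ T.domain) : P (app T x) = x :=
  (h x _).1 ((mem_graph_iff_app T).2 ⟨hx, rfl⟩)

theorem injective : Function.Injective P := fun y z hyz => by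
  rw [← h.app_apply y, hyz, h.app_apply]

end IsBoundedInverse

theorem inner_app_comm [CompleteSpace E] {A : E →ₗ.[𝕜] E} (hA : IsSelfAdjoint A) {x y : E}
    (hx : x ∈ A.domain) (hy : y ∈ A.domain) : ⟪app A x, y⟫_𝕜 = ⟪x, app A y⟫_𝕜 := by
  have h : A.IsFormalAdjoint A := by
    have h0 := LinearPMap.adjoint_isFormalAdjoint hA.dense_domain
    rwa [LinearPMap.isSelfAdjoint_def.1 hA] at h0
  have := h ⟨x, hx⟩ ⟨y, hy⟩
  rwa [← app_of_mem A hx, ← app_of_mem A hy] at this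

/-- This is the inclusion of `A*` in `A`, the half of self-adjointness that symmetry does not give.
-/
theorem mem_graph_of_isSelfAdjoint [CompleteSpace E] {A : E →ₗ.[𝕜] E} (hA : IsSelfAdjoint A)
    {y w : E} (h : ∀ x ∈ A.domain, ⟪x, w⟫_𝕜 = ⟪app A x, y⟫_𝕜) : (y, w) ∈ A.graph := by
  have h' : ∀ x : A.domain, ⟪w, (x : E)⟫_𝕜 = ⟪y, A x⟫_𝕜 := fun x => by
    rw [← inner_conj_symm, h x x.2, inner_conj_symm, app_of_mem A x.2]
  have hm := LinearPMap.mem_adjoint_domain_of_exists y ⟨w, h'⟩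
  have he := LinearPMap.adjoint_apply_eq hA.dense_domain ⟨y, hm⟩ h'
  rw [← LinearPMap.isSelfAdjoint_def.1 hA]
  exact LinearPMap.mem_graph_iff _ |>.2 ⟨⟨y, hm⟩, rfl, he⟩

/-- A symmetric bijective operator has a bounded symmetric inverse. -/
theorem exists_isBoundedInverse [CompleteSpace E] {T : E →ₗ.[𝕜] E}
    (hsymm : ∀ x ∈ T.domain, ∀ y ∈ T.domain, ⟪app T x, y⟫_𝕜 = ⟪x, app T y⟫_𝕜)
    (hinj : ∀ x, (x, 0) ∈ T.graph → x = 0) (hsurj : ∀ z, ∃ x, (x, z) ∈ T.graph) :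
    ∃ P : E →L[𝕜] E, IsSelfAdjoint P ∧ IsBoundedInverse T P := by
  choose f hf using hsurj
  have huniq : ∀ {x z}, (x, z) ∈ T.graph → f z = x := fun {x z} hx => by
    have := T.graph.sub_mem (hf z) hx
    rw [Prod.mk_sub_mk, sub_self] at this
    exact sub_eq_zero.1 (hinj _ this)
  let P : E →ₗ[𝕜] E :=
    { toFun := f
      map_add' := fun x y => huniq (T.graph.add_mem (hf x) (hf y))
      map_smul' := fun c x => huniq (T.graph.smul_mem c (hf x)) }
  have hP : P.IsSymmetric := fun x y => by
    obtain ⟨hx, hx'⟩ := (mem_graph_iff_app T).1 (hf x)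
    obtain ⟨hy, hy'⟩ := (mem_graph_iff_app T).1 (hf y)
    have := hsymm _ hx _ hy
    rw [hx', hy'] at this
    exact this.symm
  -- Hellinger–Toeplitz: an everywhere defined symmetric operator is bounded.
  refine ⟨⟨P, hP.continuous⟩, ContinuousLinearMap.isSelfAdjoint_iff_isSymmetric.2 hP,
    fun x z => ⟨fun hx => huniq hx, ?_⟩⟩
  rintro rfl
  exact hf z

/-- The lower bound gives injectivity and, with the closed graph, a closed range; a vector
orthogonal to the range lies in the kernel, so `A` is onto. -/
theorem IsPositiveSelfAdjoint.exists_inverse [CompleteSpace E] {A : E →ₗ.[𝕜] E}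
    (hA : IsPositiveSelfAdjoint A) :
    ∃ Q : E →L[𝕜] E, Q.IsPositive ∧ IsBoundedInverse A Q := by
  obtain ⟨hsa, m, hm, hlow⟩ := hA
  have hlow' : ∀ x ∈ A.domain, m * ‖x‖ ≤ ‖app A x‖ := fun x hx => by
    rcases (norm_nonneg x).eq_or_lt with h0 | h0
    · rw [← h0, mul_zero]; exact norm_nonneg _
    · have h1 := (hlow x hx).trans (re_inner_le_norm _ _)
      rw [sq, ← mul_assoc] at h1
      exact le_of_mul_le_mul_right h1 h0
  have hinj : ∀ x, (x, (0 : E)) ∈ A.graph → x = 0 := fun x hx => by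
    obtain ⟨hx, h0⟩ := (mem_graph_iff_app A).1 hx
    have := hlow' x hx
    rw [h0, norm_zero] at this
    exact norm_le_zero_iff.1 (nonpos_of_mul_nonpos_right this hm)
  -- The range of `A` is the range of a bounded map on the complete space `A.graph`. The graph
  -- carries the sup norm, whence the constant `max m⁻¹ 1`.
  let f : A.graph →L[𝕜] E := (ContinuousLinearMap.snd 𝕜 E E).comp A.graph.subtypeL
  have hcl : IsClosed (LinearMap.range f.toLinearMap : Set E) := by
    have : IsComplete (A.graph : Set (E × E)) := hsa.isClosed.isComplete
    have : CompleteSpace A.graph := this.completeSpace_coe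
    have hanti : AntilipschitzWith (max m⁻¹ 1).toNNReal f := by
      refine f.antilipschitz_of_bound fun x => ?_
      obtain ⟨⟨x, z⟩, hxz⟩ := x
      obtain ⟨hx, rfl⟩ := (mem_graph_iff_app A).1 hxz
      rw [Real.coe_toNNReal _ (le_max_of_le_right zero_le_one)]
      change max ‖x‖ ‖app A x‖ ≤ max m⁻¹ 1 * ‖app A x‖
      rw [max_mul_of_nonneg _ _ (norm_nonneg _), one_mul]
      refine max_le_max_right _ ?_
      rw [le_inv_mul_iff₀ hm]
      exact hlow' x hx
    have := hanti.isClosed_range f.uniformContinuous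
    rwa [LinearMap.coe_range]
  have hbot : (LinearMap.range f.toLinearMap)ᗮ = ⊥ := by
    rw [Submodule.eq_bot_iff]
    intro y hy
    refine hinj y (mem_graph_of_isSelfAdjoint hsa fun x hx => ?_)
    rw [inner_zero_right]
    exact ((Submodule.mem_orthogonal _ _).1 hy _
      ⟨⟨(x, app A x), (mem_graph_iff_app A).2 ⟨hx, rfl⟩⟩, rfl⟩).symm
  have hsurj : ∀ z, ∃ x, (x, z) ∈ A.graph := fun z => by
    have : CompleteSpace (LinearMap.range f.toLinearMap) := hcl.isComplete.completeSpace_coe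
    have htop := (Submodule.orthogonal_eq_bot_iff).1 hbot
    obtain ⟨⟨⟨x, z'⟩, hx⟩, rfl⟩ : z ∈ LinearMap.range f.toLinearMap := htop ▸ Submodule.mem_top
    exact ⟨x, hx⟩
  obtain ⟨Q, hQ, hAQ⟩ := exists_isBoundedInverse
    (fun x hx y hy => inner_app_comm hsa hx hy) hinj hsurj
  refine ⟨Q, ContinuousLinearMap.isPositive_def'.2 ⟨hQ, fun z => ?_⟩, hAQ⟩
  rw [ContinuousLinearMap.reApplyInnerSelf_apply, inner_re_symm]
  have := hlow _ (hAQ.apply_mem z)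
  rw [hAQ.app_apply] at this
  exact (by positivity : (0 : ℝ) ≤ m * ‖Q z‖ ^ 2).trans this

theorem dense_range_of_isSelfAdjoint [CompleteSpace E] {P : E →L[𝕜] E} (hP : IsSelfAdjoint P)
    (hinj : Function.Injective P) : DenseRange P := by
  have h : (LinearMap.range P.toLinearMap)ᗮ = ⊥ := by
    rw [ContinuousLinearMap.orthogonal_range, ContinuousLinearMap.isSelfAdjoint_iff'.1 hP]
    exact LinearMap.ker_eq_bot.2 hinj
  rw [← Submodule.topologicalClosure_eq_top_iff] at h
  exact (Submodule.dense_iff_topologicalClosure_eq_top).2 h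

/-- The root is `P⁻¹`, where `P` is the positive square root of `Q = A⁻¹`. -/
theorem exists_isNonnegSqrt [CompleteSpace E] {A : E →ₗ.[𝕜] E} {Q : E →L[𝕜] E}
    (hQ : Q.IsPositive) (hAQ : IsBoundedInverse A Q) : ∃ S, IsNonnegSqrt A S := by
  obtain ⟨P, hP, hPP⟩ := exists_isPositive_sq hQ
  have hPP' : ∀ z, P (P z) = Q z := fun z => by rw [← hPP]; rfl
  have hinj : Function.Injective P := fun y z hyz => hAQ.injective (by
    rw [← hPP', ← hPP', hyz])
  -- The flipped graph `{(P z, z)}`, which is a graph because `P` is injective.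
  let g : Submodule 𝕜 (E × E) := LinearMap.range (P.toLinearMap.prod LinearMap.id)
  have hg : ∀ {x z}, (x, z) ∈ g ↔ P z = x := fun {x z} => by
    constructor
    · rintro ⟨y, hy⟩
      obtain ⟨rfl, rfl⟩ := Prod.mk.inj hy
      rfl
    · rintro rfl
      exact ⟨z, rfl⟩
  let S := g.toLinearPMap
  have hS : IsBoundedInverse S P := fun x z => by
    have : S.graph = g := Submodule.toLinearPMap_graph_eq g fun x hx hx0 => by
      obtain ⟨a, b⟩ := x
      have := hg.1 hx
      dsimp only at hx0 ⊢
      exact hinj (by rw [this, hx0, map_zero])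
    rw [this, hg]
  have hsymm : ∀ x y, ⟪P x, y⟫_𝕜 = ⟪x, P y⟫_𝕜 := hP.inner_left_eq_inner_right
  have hdense : Dense (S.domain : Set E) :=
    (dense_range_of_isSelfAdjoint hP.isSelfAdjoint hinj).mono (by
      rintro _ ⟨z, rfl⟩; exact hS.apply_mem z)
  refine ⟨S, ?_, fun x hx => ?_, fun x z => ?_⟩
  · rw [LinearPMap.isSelfAdjoint_def]
    refine LinearPMap.eq_of_eq_graph ?_
    rw [LinearPMap.adjoint_graph_eq_graph_adjoint hdense]
    ext ⟨y, w⟩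
    rw [Submodule.mem_adjoint_iff, hS]
    constructor
    · intro h
      refine (ext_inner_left 𝕜 fun v => ?_ : P w = y)
      have := h (P v) v ((hS _ _).2 rfl)
      rw [← hsymm]
      exact (sub_eq_zero.1 this).symm
    · rintro rfl a b hab
      rw [hS] at hab
      rw [← hab, hsymm, sub_self]
  · have := hP.re_inner_nonneg_right (app S x)
    rwa [hS.apply_app hx] at this
  · rw [hAQ]
    constructor
    · rintro rfl
      exact ⟨P z, (hS _ _).2 (hPP' z), (hS _ _).2 rfl⟩
    · rintro ⟨y, h1, h2⟩
      rw [hS] at h1 h2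
      rw [← h1, ← h2, hPP']

theorem sqrtOp_isNonnegSqrt [CompleteSpace E] {A : E →ₗ.[𝕜] E} (h : ∃ S, IsNonnegSqrt A S) :
    IsNonnegSqrt A (sqrtOp A) := by
  rw [sqrtOp, dif_pos h]
  exact h.choose_spec

/-- The square root of the inverse of `Q` is the inverse of a square root of `Q`. -/
theorem exists_sqrtOp_inverse [CompleteSpace E] {A : E →ₗ.[𝕜] E} {Q : E →L[𝕜] E}
    (hQ : Q.IsPositive) (hAQ : IsBoundedInverse A Q) :
    IsNonnegSqrt A (sqrtOp A) ∧ ∃ P : E →L[𝕜] E, IsSelfAdjoint P ∧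
      (∀ z, P (P z) = Q z) ∧ IsBoundedInverse (sqrtOp A) P := by
  have hS := sqrtOp_isNonnegSqrt (exists_isNonnegSqrt hQ hAQ)
  refine ⟨hS, ?_⟩
  obtain ⟨hsa, -, hsq⟩ := hS
  obtain ⟨P, hP, hSP⟩ := exists_isBoundedInverse
    (fun x hx y hy => inner_app_comm hsa hx hy)
    (fun x hx => by
      have := (hAQ _ _).1 ((hsq x 0).2 ⟨0, hx, Submodule.zero_mem _⟩)
      rw [← this, map_zero])
    (fun z => by
      obtain ⟨y, -, hy⟩ := (hsq (Q z) z).1 ((hAQ _ _).2 rfl)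
      exact ⟨y, hy⟩)
  exact ⟨P, hP, fun z => ((hAQ _ _).1 ((hsq _ _).2
    ⟨P z, (hSP _ _).2 rfl, (hSP _ _).2 rfl⟩)).symm, hSP⟩

/-- If `P² = R R*` with `P` self-adjoint, `P` and `R` differ by a unitary operator. -/
theorem exists_linearIsometryEquiv_of_sq_eq [CompleteSpace E] {P R : E →L[𝕜] E}
    (hP : IsSelfAdjoint P) (hPinj : Function.Injective P) (hRinj : Function.Injective R)
    (hPR : ∀ z, P (P z) = R (ContinuousLinearMap.adjoint R z)) :
    ∃ V : E ≃ₗᵢ[𝕜] E, ∀ z, P (V z) = R z := by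
  have hsymm : ∀ x y, ⟪P x, y⟫_𝕜 = ⟪x, P y⟫_𝕜 :=
    ContinuousLinearMap.isSelfAdjoint_iff_isSymmetric.1 hP
  have hRd : DenseRange (ContinuousLinearMap.adjoint R) := by
    have h : (LinearMap.range (ContinuousLinearMap.adjoint R).toLinearMap)ᗮ = ⊥ := by
      rw [ContinuousLinearMap.orthogonal_range, ContinuousLinearMap.adjoint_adjoint]
      exact LinearMap.ker_eq_bot.2 hRinj
    rw [← Submodule.topologicalClosure_eq_top_iff] at h
    exact (Submodule.dense_iff_topologicalClosure_eq_top).2 h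
  have hnorm : ∀ x, ‖P x‖ = ‖ContinuousLinearMap.adjoint R x‖ := fun x => by
    have h : ‖P x‖ ^ 2 = ‖ContinuousLinearMap.adjoint R x‖ ^ 2 := by
      rw [← @inner_self_eq_norm_sq 𝕜, ← @inner_self_eq_norm_sq 𝕜, hsymm, hPR,
        ContinuousLinearMap.adjoint_inner_left]
    exact (sq_eq_sq₀ (norm_nonneg _) (norm_nonneg _)).1 h
  -- `R* x ↦ P x` is isometric between dense ranges, hence extends to a unitary `V` with `V R* = P`.
  -- Taking adjoints gives `R V⁻¹ = P`.
  let V : E ≃ₗᵢ[𝕜] E := (LinearEquiv.refl 𝕜 E).extendOfIsometry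
    (ContinuousLinearMap.adjoint R).toLinearMap P.toLinearMap hRd
    (dense_range_of_isSelfAdjoint hP hPinj) hnorm
  have hV : ∀ x, V (ContinuousLinearMap.adjoint R x) = P x := fun x =>
    LinearEquiv.extendOfIsometry_eq _ _ _ _ _ _ x
  refine ⟨V, fun z => ext_inner_left 𝕜 fun x => ?_⟩
  rw [← hsymm, ← hV, LinearIsometryEquiv.inner_map_map, ContinuousLinearMap.adjoint_inner_left]

end BoundedInverse

/-! ### The factorisation of the operator matrix and its square root. -/

section EnergyInverse

variable {𝕜 H₁ H₂ : Type*} [RCLike 𝕜]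
  [NormedAddCommGroup H₁] [InnerProductSpace 𝕜 H₁]
  [NormedAddCommGroup H₂] [InnerProductSpace 𝕜 H₂]

/-- The inverse of `(u, v) ↦ (A₁^{1/2} u, C* u + A₂^{1/2} v)`. -/
noncomputable def energyInverse (P₁ : H₁ →L[𝕜] H₁) (P₂ : H₂ →L[𝕜] H₂) (K : H₁ →L[𝕜] H₂) :
    WithLp 2 (H₁ × H₂) →L[𝕜] WithLp 2 (H₁ × H₂) :=
  (WithLp.prodContinuousLinearEquiv 2 𝕜 H₁ H₂).symm.toContinuousLinearMap.comp
    ((P₁.comp (WithLp.fstL 2 𝕜 H₁ H₂)).prod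
      (P₂.comp (WithLp.sndL 2 𝕜 H₁ H₂ - K.comp (WithLp.fstL 2 𝕜 H₁ H₂))))

theorem energyInverse_apply (P₁ : H₁ →L[𝕜] H₁) (P₂ : H₂ →L[𝕜] H₂) (K : H₁ →L[𝕜] H₂)
    (p : WithLp 2 (H₁ × H₂)) :
    energyInverse P₁ P₂ K p = WithLp.toLp 2 (P₁ p.fst, P₂ (p.snd - K p.fst)) := rfl

end EnergyInverse

section CoupledOperator

variable {𝕜 H₁ H₂ : Type*} [RCLike 𝕜]
  [NormedAddCommGroup H₁] [InnerProductSpace 𝕜 H₁] [CompleteSpace H₁]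
  [NormedAddCommGroup H₂] [InnerProductSpace 𝕜 H₂] [CompleteSpace H₂]

/-- `P₁` and `P₂` are the inverses of `A₁^{1/2}` and `A₂^{1/2}`, and `K = C* A₁^{-1/2}` is
bounded. -/
structure CouplingInverses (A₁ : H₁ →ₗ.[𝕜] H₁) (A₂ : H₂ →ₗ.[𝕜] H₂) (C : H₂ →ₗ.[𝕜] H₁)
    (P₁ : H₁ →L[𝕜] H₁) (P₂ : H₂ →L[𝕜] H₂) (K : H₁ →L[𝕜] H₂) : Prop where
  inv₁ : IsBoundedInverse (sqrtOp A₁) P₁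
  inv₂ : IsBoundedInverse (sqrtOp A₂) P₂
  sq₁ : IsBoundedInverse A₁ (P₁.comp P₁)
  sq₂ : IsBoundedInverse A₂ (P₂.comp P₂)
  symm₁ : ∀ x y, ⟪P₁ x, y⟫_𝕜 = ⟪x, P₁ y⟫_𝕜
  symm₂ : ∀ x y, ⟪P₂ x, y⟫_𝕜 = ⟪x, P₂ y⟫_𝕜
  mem_adjoint : ∀ {x}, x ∈ (sqrtOp A₁).domain → x ∈ C.adjoint.domain
  mem_coupling : ∀ {y}, y ∈ (sqrtOp A₂).domain → y ∈ C.domain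
  adjoint_apply : ∀ z, app C.adjoint (P₁ z) = K z
  inner_adjoint : ∀ {x y}, x ∈ C.adjoint.domain → y ∈ C.domain →
    ⟪app C.adjoint x, y⟫_𝕜 = ⟪x, app C y⟫_𝕜

theorem exists_couplingInverses {A₁ : H₁ →ₗ.[𝕜] H₁} {A₂ : H₂ →ₗ.[𝕜] H₂} {C : H₂ →ₗ.[𝕜] H₁}
    (hA₁ : IsPositiveSelfAdjoint A₁) (hA₂ : IsPositiveSelfAdjoint A₂)
    (hCadj : DomainEmbeds (sqrtOp A₁) C.adjoint) (hC : DomainEmbeds (sqrtOp A₂) C) :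
    ∃ P₁ P₂ K, CouplingInverses A₁ A₂ C P₁ P₂ K := by
  obtain ⟨Q₁, hQ₁, hAQ₁⟩ := hA₁.exists_inverse
  obtain ⟨Q₂, hQ₂, hAQ₂⟩ := hA₂.exists_inverse
  obtain ⟨-, P₁, hP₁, hPP₁, hSP₁⟩ := exists_sqrtOp_inverse hQ₁ hAQ₁
  obtain ⟨hS₂, P₂, hP₂, hPP₂, hSP₂⟩ := exists_sqrtOp_inverse hQ₂ hAQ₂
  obtain ⟨hle, c, hc⟩ := hCadj
  let K₀ : H₁ →ₗ[𝕜] H₂ :=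
    { toFun := fun z => app C.adjoint (P₁ z)
      map_add' := fun x y => by
        rw [map_add, app_add _ (hle (hSP₁.apply_mem x)) (hle (hSP₁.apply_mem y))]
      map_smul' := fun a x => by
        rw [map_smul, app_smul _ a (hle (hSP₁.apply_mem x)), RingHom.id_apply] }
  let K : H₁ →L[𝕜] H₂ := LinearMap.mkContinuous K₀ c fun z => by
    have := hc _ (hSP₁.apply_mem z)
    rw [hSP₁.app_apply] at this
    exact (le_add_of_nonneg_left (norm_nonneg _)).trans this
  -- Density of `D(C)` is what makes `C.adjoint` a genuine formal adjoint.
  have hdense : Dense (C.domain : Set H₂) := hS₂.1.dense_domain.mono hC.1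
  refine ⟨P₁, P₂, K, hSP₁, hSP₂, ?_, ?_, ContinuousLinearMap.isSelfAdjoint_iff_isSymmetric.1 hP₁,
    ContinuousLinearMap.isSelfAdjoint_iff_isSymmetric.1 hP₂, fun hx => hle hx,
    fun hy => hC.1 hy, fun z => rfl, fun {x y} hx hy => ?_⟩
  · rwa [show P₁.comp P₁ = Q₁ from ContinuousLinearMap.ext hPP₁]
  · rwa [show P₂.comp P₂ = Q₂ from ContinuousLinearMap.ext hPP₂]
  · rw [app_of_mem _ hx, app_of_mem _ hy]
    exact LinearPMap.adjoint_isFormalAdjoint hdense ⟨x, hx⟩ ⟨y, hy⟩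

namespace CouplingInverses

variable {A₁ : H₁ →ₗ.[𝕜] H₁} {A₂ : H₂ →ₗ.[𝕜] H₂} {C : H₂ →ₗ.[𝕜] H₁}
  {P₁ : H₁ →L[𝕜] H₁} {P₂ : H₂ →L[𝕜] H₂} {K : H₁ →L[𝕜] H₂}

theorem app_adjoint (h : CouplingInverses A₁ A₂ C P₁ P₂ K) {x : H₁}
    (hx : x ∈ (sqrtOp A₁).domain) : app C.adjoint x = K (app (sqrtOp A₁) x) := by
  rw [← h.adjoint_apply, h.inv₁.apply_app hx]

/-- The bounded operator `K*` extends `A₁^{-1/2} C`; this identifies the adjoint of `energyInverse`.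
-/
theorem adjoint_comp_apply (h : CouplingInverses A₁ A₂ C P₁ P₂ K) {y : H₂}
    (hy : y ∈ (sqrtOp A₂).domain) : ContinuousLinearMap.adjoint K y = P₁ (app C y) := by
  refine ext_inner_left 𝕜 fun z => ?_
  rw [ContinuousLinearMap.adjoint_inner_right, ← h.adjoint_apply, ← h.symm₁,
    h.inner_adjoint (h.mem_adjoint (h.inv₁.apply_mem z)) (h.mem_coupling hy)]

theorem app_eq_sqrt_sqrt₂ (h : CouplingInverses A₁ A₂ C P₁ P₂ K) {y : H₂} (hy : y ∈ A₂.domain) :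
    y ∈ (sqrtOp A₂).domain ∧ app (sqrtOp A₂) y = P₂ (app A₂ y) := by
  have e : P₂ (P₂ (app A₂ y)) = y := h.sq₂.apply_app hy
  constructor
  · rw [← e]; exact h.inv₂.apply_mem _
  · conv_lhs => rw [← e, h.inv₂.app_apply]

theorem adjoint_energyInverse_apply (h : CouplingInverses A₁ A₂ C P₁ P₂ K)
    (q : WithLp 2 (H₁ × H₂)) :
    ContinuousLinearMap.adjoint (energyInverse P₁ P₂ K) q =
      WithLp.toLp 2 (P₁ (q.fst - app C (P₂ q.snd)), P₂ q.snd) := by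
  refine ext_inner_left 𝕜 fun p => ?_
  rw [ContinuousLinearMap.adjoint_inner_right, energyInverse_apply, WithLp.prod_inner_apply,
    WithLp.prod_inner_apply]
  simp only [WithLp.ofLp_fst, WithLp.ofLp_snd]
  rw [h.symm₁, h.symm₂, map_sub, ← h.adjoint_comp_apply (h.inv₂.apply_mem _), inner_sub_left,
    inner_sub_right, ContinuousLinearMap.adjoint_inner_right]
  ring

/-- `A (u, v) = q` is solved by back substitution: the second row gives `c = C* u + A₂^{1/2} v = P₂
q₂`, the first gives `A₁ u = q₁ - C c`, and then `v = P₂ (c - C* u)`. The result is `R R* q`. -/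
theorem isBoundedInverse_matrixOp (h : CouplingInverses A₁ A₂ C P₁ P₂ K) :
    IsBoundedInverse (matrixOp A₁ A₂ C)
      ((energyInverse P₁ P₂ K).comp (ContinuousLinearMap.adjoint (energyInverse P₁ P₂ K))) := by
  intro p q
  rw [ContinuousLinearMap.comp_apply, h.adjoint_energyInverse_apply, energyInverse_apply]
  simp only [WithLp.toLp_fst, WithLp.toLp_snd]
  constructor
  · intro hpq
    obtain ⟨hp, rfl⟩ := (mem_graph_iff_app _).1 hpq
    rw [app_of_mem _ hp]
    obtain ⟨h1, h2, h3, h4, h5⟩ := hp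
    change WithLp.toLp 2 (P₁ (P₁ (app A₁ p.fst + app C (couple A₂ C p)
        - app C (P₂ (app (sqrtOp A₂) (couple A₂ C p))))),
      P₂ (P₂ (app (sqrtOp A₂) (couple A₂ C p)) - K (P₁ (app A₁ p.fst + app C (couple A₂ C p)
        - app C (P₂ (app (sqrtOp A₂) (couple A₂ C p))))))) = p
    rw [h.inv₂.apply_app h4, add_sub_cancel_right, ← h.adjoint_apply]
    have e : P₁ (P₁ (app A₁ p.fst)) = p.fst := h.sq₁.apply_app h1
    rw [e, couple, add_sub_cancel_left, h.inv₂.apply_app h3]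
    rfl
  · rintro rfl
    set x := q.fst - app C (P₂ q.snd) with hx
    have hu : app A₁ (P₁ (P₁ x)) = x := h.sq₁.app_apply x
    have hc : couple A₂ C (WithLp.toLp 2 (P₁ (P₁ x), P₂ (P₂ q.snd - K (P₁ x)))) = P₂ q.snd := by
      simp only [couple, WithLp.toLp_fst, WithLp.toLp_snd]
      rw [h.adjoint_apply, h.inv₂.app_apply, add_sub_cancel]
    have hm : WithLp.toLp 2 (P₁ (P₁ x), P₂ (P₂ q.snd - K (P₁ x))) ∈
        (matrixOp A₁ A₂ C).domain := by
      refine ⟨h.sq₁.apply_mem x, h.mem_adjoint (h.inv₁.apply_mem _), h.inv₂.apply_mem _, ?_, ?_⟩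
      · rw [hc]; exact h.inv₂.apply_mem _
      · rw [hc]; exact h.mem_coupling (h.inv₂.apply_mem _)
    refine (mem_graph_iff_app _).2 ⟨hm, ?_⟩
    rw [app_of_mem _ hm]
    change WithLp.toLp 2 (app A₁ (P₁ (P₁ x)) + app C (couple A₂ C _),
      app (sqrtOp A₂) (couple A₂ C _)) = q
    rw [hc, hu, h.inv₂.app_apply, hx, sub_add_cancel]
    rfl

/-- The square root of the operator matrix is, up to a unitary operator, the operator
`(u, v) ↦ (A₁^{1/2} u, C* u + A₂^{1/2} v)` on `D(A₁^{1/2}) × D(A₂^{1/2})`. -/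
theorem exists_sqrtOp_matrixOp (h : CouplingInverses A₁ A₂ C P₁ P₂ K) :
    ∃ V : WithLp 2 (H₁ × H₂) ≃ₗᵢ[𝕜] WithLp 2 (H₁ × H₂),
      ∀ p, (p ∈ (sqrtOp (matrixOp A₁ A₂ C)).domain ↔
        p.fst ∈ (sqrtOp A₁).domain ∧ p.snd ∈ (sqrtOp A₂).domain) ∧
      (p ∈ (sqrtOp (matrixOp A₁ A₂ C)).domain → app (sqrtOp (matrixOp A₁ A₂ C)) p =
        V (WithLp.toLp 2 (app (sqrtOp A₁) p.fst, couple A₂ C p))) := by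
  -- Positivity of `R R*` is automatic, so the matrix needs no separate proof of self-adjointness.
  obtain ⟨-, P, hP, hPP, hSP⟩ := exists_sqrtOp_inverse
    (ContinuousLinearMap.isPositive_self_comp_adjoint _) h.isBoundedInverse_matrixOp
  have hinj : Function.Injective (energyInverse P₁ P₂ K) := fun p q hpq => by
    rw [energyInverse_apply, energyInverse_apply] at hpq
    obtain ⟨h1, h2⟩ := Prod.mk.inj ((WithLp.toLp_injective 2) hpq)
    have h1 := h.inv₁.injective h1
    have h2 := h.inv₂.injective h2
    rw [h1, sub_left_inj] at h2
    exact WithLp.ofLp_injective 2 (Prod.ext h1 h2)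
  obtain ⟨V, hV⟩ := exists_linearIsometryEquiv_of_sq_eq hP hSP.injective hinj hPP
  have key : ∀ p : WithLp 2 (H₁ × H₂), p.fst ∈ (sqrtOp A₁).domain → p.snd ∈ (sqrtOp A₂).domain →
      P (V (WithLp.toLp 2 (app (sqrtOp A₁) p.fst, couple A₂ C p))) = p := fun p h1 h2 => by
    rw [hV, energyInverse_apply]
    simp only [WithLp.toLp_fst, WithLp.toLp_snd]
    rw [couple, h.app_adjoint h1, add_sub_cancel_left, h.inv₁.apply_app h1, h.inv₂.apply_app h2]
    rfl
  have hmem : ∀ p : WithLp 2 (H₁ × H₂), p ∈ (sqrtOp (matrixOp A₁ A₂ C)).domain ↔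
      p.fst ∈ (sqrtOp A₁).domain ∧ p.snd ∈ (sqrtOp A₂).domain := fun p => by
    constructor
    · intro hp
      rw [← hSP.apply_app hp, ← V.apply_symm_apply (app _ p), hV, energyInverse_apply]
      exact ⟨h.inv₁.apply_mem _, h.inv₂.apply_mem _⟩
    · rintro ⟨h1, h2⟩
      rw [← key p h1 h2]
      exact hSP.apply_mem _
  refine ⟨V, fun p => ⟨hmem p, fun hp => ?_⟩⟩
  obtain ⟨h1, h2⟩ := (hmem p).1 hp
  conv_lhs => rw [← key p h1 h2, hSP.app_apply]

end CouplingInverses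

end CoupledOperator

/-! ### Calculus of `C¹` curves on the half-line. -/

section TimeRegularity

variable {𝕜 E F : Type*} [RCLike 𝕜] [NormedAddCommGroup E] [InnerProductSpace 𝕜 E]
  [NormedAddCommGroup F] [InnerProductSpace 𝕜 F]

namespace IsC1

variable {f f' g g' : ℝ → E}

theorem congr (hf : IsC1 𝕜 f f') (h : ∀ t : ℝ, 0 ≤ t → g t = f t)
    (h' : ∀ t : ℝ, 0 ≤ t → g' t = f' t) : IsC1 𝕜 g g' := by
  let : NormedSpace ℝ E := NormedSpace.restrictScalars ℝ 𝕜 E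
  refine ⟨fun t ht => ?_, hf.2.congr fun t ht => h' t ht⟩
  rw [h' t ht]
  exact (hf.1 t ht).congr (fun s hs => h s hs) (h t ht)

theorem add (hf : IsC1 𝕜 f f') (hg : IsC1 𝕜 g g') :
    IsC1 𝕜 (fun t => f t + g t) (fun t => f' t + g' t) := by
  let : NormedSpace ℝ E := NormedSpace.restrictScalars ℝ 𝕜 E
  exact ⟨fun t ht => (hf.1 t ht).add (hg.1 t ht), hf.2.add hg.2⟩

theorem sub (hf : IsC1 𝕜 f f') (hg : IsC1 𝕜 g g') :
    IsC1 𝕜 (fun t => f t - g t) (fun t => f' t - g' t) := by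
  let : NormedSpace ℝ E := NormedSpace.restrictScalars ℝ 𝕜 E
  exact ⟨fun t ht => (hf.1 t ht).sub (hg.1 t ht), hf.2.sub hg.2⟩

theorem neg (hf : IsC1 𝕜 f f') : IsC1 𝕜 (fun t => -f t) (fun t => -f' t) := by
  let : NormedSpace ℝ E := NormedSpace.restrictScalars ℝ 𝕜 E
  exact ⟨fun t ht => (hf.1 t ht).neg, hf.2.neg⟩

theorem clm (hf : IsC1 𝕜 f f') (L : E →L[𝕜] F) :
    IsC1 𝕜 (fun t => L (f t)) (fun t => L (f' t)) := by
  let : NormedSpace ℝ E := NormedSpace.restrictScalars ℝ 𝕜 E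
  let : NormedSpace ℝ F := NormedSpace.restrictScalars ℝ 𝕜 F
  exact ⟨fun t ht => (L.restrictScalars ℝ).hasFDerivAt.comp_hasDerivWithinAt t (hf.1 t ht),
    L.continuous.comp_continuousOn hf.2⟩

theorem fst {f f' : ℝ → WithLp 2 (E × F)} (hf : IsC1 𝕜 f f') :
    IsC1 𝕜 (fun t => (f t).fst) (fun t => (f' t).fst) :=
  hf.clm (WithLp.fstL 2 𝕜 E F)

theorem snd {f f' : ℝ → WithLp 2 (E × F)} (hf : IsC1 𝕜 f f') :
    IsC1 𝕜 (fun t => (f t).snd) (fun t => (f' t).snd) :=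
  hf.clm (WithLp.sndL 2 𝕜 E F)

theorem toLp_prod {g g' : ℝ → F} (hf : IsC1 𝕜 f f') (hg : IsC1 𝕜 g g') :
    IsC1 𝕜 (fun t => WithLp.toLp 2 (f t, g t)) (fun t => WithLp.toLp 2 (f' t, g' t)) := by
  let e : E × F →L[𝕜] WithLp 2 (E × F) :=
    (WithLp.prodContinuousLinearEquiv 2 𝕜 E F).symm.toContinuousLinearMap
  have key : ∀ x y, WithLp.toLp 2 (x, y) = e.comp (ContinuousLinearMap.inl 𝕜 E F) x
      + e.comp (ContinuousLinearMap.inr 𝕜 E F) y := fun x y => by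
    rw [ContinuousLinearMap.comp_apply, ContinuousLinearMap.comp_apply, ← map_add]
    simp [e]
  exact ((hf.clm (e.comp (.inl 𝕜 E F))).add (hg.clm (e.comp (.inr 𝕜 E F)))).congr
    (fun t _ => key _ _) (fun t _ => key _ _)

end IsC1

theorem ControlOperator.pair_zero {U : Type*} [NormedAddCommGroup U] [InnerProductSpace 𝕜 U]
    {S : E →ₗ.[𝕜] E} (B : ControlOperator S U) (u : U) : B.pair u 0 = 0 := by
  rw [ControlOperator.pair, dif_pos S.domain.zero_mem]
  exact map_zero (B.toFun u)

end TimeRegularity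

/-! ### Comparison of energies and transfer of solutions between the systems. -/

section Equivalence

variable {𝕜 H₁ H₂ U : Type*} [RCLike 𝕜]
  [NormedAddCommGroup H₁] [InnerProductSpace 𝕜 H₁] [CompleteSpace H₁]
  [NormedAddCommGroup H₂] [InnerProductSpace 𝕜 H₂] [CompleteSpace H₂]
  [NormedAddCommGroup U] [InnerProductSpace 𝕜 U] [CompleteSpace U]
  {A₁ : H₁ →ₗ.[𝕜] H₁} {A₂ : H₂ →ₗ.[𝕜] H₂} {C : H₂ →ₗ.[𝕜] H₁}
  {P₁ : H₁ →L[𝕜] H₁} {P₂ : H₂ →L[𝕜] H₂} {K : H₁ →L[𝕜] H₂}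
  {B : ControlOperator (sqrtOp A₁) U}

/-- The energy `½ (‖A₁^{1/2} u‖² + ‖C* u + A₂^{1/2} v‖² + ‖u'‖² + ‖v'‖²)`. -/
noncomputable def energyCoupled (A₁ : H₁ →ₗ.[𝕜] H₁) (A₂ : H₂ →ₗ.[𝕜] H₂) (C : H₂ →ₗ.[𝕜] H₁)
    (u u' : ℝ → H₁) (v v' : ℝ → H₂) (t : ℝ) : ℝ :=
  1 / 2 * (‖app (sqrtOp A₁) (u t)‖ ^ 2 + ‖app C.adjoint (u t) + app (sqrtOp A₂) (v t)‖ ^ 2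
    + (‖u' t‖ ^ 2 + ‖v' t‖ ^ 2))

/-- The constant `2` would do; the larger one is shared with the reverse estimate `energyUV_le`. -/
theorem energyCoupled_le (u u' : ℝ → H₁) (v v' : ℝ → H₂) (t : ℝ) :
    energyCoupled A₁ A₂ C u u' v v' t ≤ (3 + 3 * ‖K‖ ^ 2) * energyUV A₁ A₂ C u u' v v' t := by
  rw [energyCoupled, energyUV]
  have h1 := norm_add_le (app C.adjoint (u t)) (app (sqrtOp A₂) (v t))
  have h2 : ‖app C.adjoint (u t) + app (sqrtOp A₂) (v t)‖ ^ 2 ≤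
      2 * (‖app C.adjoint (u t)‖ ^ 2 + ‖app (sqrtOp A₂) (v t)‖ ^ 2) :=
    (pow_le_pow_left₀ (norm_nonneg _) h1 2).trans (add_sq_le)
  set e := ‖app (sqrtOp A₁) (u t)‖ ^ 2 + ‖app (sqrtOp A₂) (v t)‖ ^ 2
    + ‖app C.adjoint (u t)‖ ^ 2 + (‖u' t‖ ^ 2 + ‖v' t‖ ^ 2) with he
  have h3 : 0 ≤ ‖K‖ ^ 2 * e := by positivity
  nlinarith [sq_nonneg ‖app (sqrtOp A₁) (u t)‖, sq_nonneg ‖u' t‖, sq_nonneg ‖v' t‖,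
    sq_nonneg ‖app C.adjoint (u t)‖, sq_nonneg ‖app (sqrtOp A₂) (v t)‖]

/-- In `3 ‖K‖²`, one `‖K‖²` bounds `‖C* u‖²` and two come from writing `A₂^{1/2} v` as `(C* u +
A₂^{1/2} v) - C* u`. -/
theorem CouplingInverses.energyUV_le (h : CouplingInverses A₁ A₂ C P₁ P₂ K) (u u' : ℝ → H₁)
    (v v' : ℝ → H₂) (t : ℝ) (hu : u t ∈ (sqrtOp A₁).domain) :
    energyUV A₁ A₂ C u u' v v' t ≤ (3 + 3 * ‖K‖ ^ 2) * energyCoupled A₁ A₂ C u u' v v' t := by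
  rw [energyCoupled, energyUV]
  have h0 : ‖app C.adjoint (u t)‖ ^ 2 ≤ ‖K‖ ^ 2 * ‖app (sqrtOp A₁) (u t)‖ ^ 2 := by
    rw [h.app_adjoint hu, ← mul_pow]
    exact pow_le_pow_left₀ (norm_nonneg _) (K.le_opNorm _) 2
  have h1 : ‖app (sqrtOp A₂) (v t)‖ ≤
      ‖app C.adjoint (u t) + app (sqrtOp A₂) (v t)‖ + ‖app C.adjoint (u t)‖ := by
    simpa using norm_sub_le (app C.adjoint (u t) + app (sqrtOp A₂) (v t)) (app C.adjoint (u t))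
  have h2 : ‖app (sqrtOp A₂) (v t)‖ ^ 2 ≤
      2 * (‖app C.adjoint (u t) + app (sqrtOp A₂) (v t)‖ ^ 2 + ‖app C.adjoint (u t)‖ ^ 2) :=
    (pow_le_pow_left₀ (norm_nonneg _) h1 2).trans (add_sq_le)
  have h3 : 0 ≤ ‖K‖ ^ 2 * (‖app C.adjoint (u t) + app (sqrtOp A₂) (v t)‖ ^ 2
    + (‖u' t‖ ^ 2 + ‖v' t‖ ^ 2)) := by positivity
  nlinarith [sq_nonneg ‖app (sqrtOp A₁) (u t)‖, sq_nonneg ‖u' t‖, sq_nonneg ‖v' t‖,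
    sq_nonneg ‖app C.adjoint (u t) + app (sqrtOp A₂) (v t)‖]

theorem exp_decay_of_comparable {e f : ℝ → ℝ} {M ω c : ℝ} (hM : 0 < M) (hc : 0 < c)
    (hfe : ∀ t : ℝ, 0 ≤ t → f t ≤ c * e t) (hef : e 0 ≤ c * f 0)
    (he : ∀ t : ℝ, 0 ≤ t → e t ≤ M * Real.exp (-ω * t) * e 0) (t : ℝ) (ht : 0 ≤ t) :
    f t ≤ c * M * c * Real.exp (-ω * t) * f 0 :=
  calc f t ≤ c * (M * Real.exp (-ω * t) * (c * f 0)) :=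
        (hfe t ht).trans (by gcongr; exact (he t ht).trans (by gcongr))
    _ = _ := by ring

namespace CouplingInverses

theorem inner_sqrtOp_comm₂ (h : CouplingInverses A₁ A₂ C P₁ P₂ K) {y w : H₂}
    (hy : y ∈ (sqrtOp A₂).domain) (hw : w ∈ (sqrtOp A₂).domain) :
    ⟪y, app (sqrtOp A₂) w⟫_𝕜 = ⟪app (sqrtOp A₂) y, w⟫_𝕜 := by
  conv_lhs => rw [← h.inv₂.apply_app hy, h.symm₂, h.inv₂.apply_app hw]

/-- Testing the second equation with `y = A₂^{-1/2} z` leaves `z` arbitrary in `H₂`. The identity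
places `C* u + A₂^{1/2} v` in `D(A₂^{1/2})` and makes it the derivative of `w₂ = -A₂^{-1/2} v'`. -/
theorem couple_eq_neg (h : CouplingInverses A₁ A₂ C P₁ P₂ K) {u u' u'' : ℝ → H₁}
    {v v' v'' : ℝ → H₂} (hs : IsSolutionUV A₁ A₂ B C u u' u'' v v' v'') {t : ℝ} (ht : 0 ≤ t) :
    -P₂ (v'' t) = app C.adjoint (u t) + app (sqrtOp A₂) (v t) := by
  refine ext_inner_left 𝕜 fun z => ?_
  have := hs.eq₂ t ht (P₂ z) (h.inv₂.apply_mem z)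
  rw [h.inv₂.app_apply, h.symm₂] at this
  rw [inner_neg_right, inner_add_right]
  linear_combination -this

/-- `(u, v) ↦ (u, -A₂^{-1/2} v')` maps solutions of the transformed system to solutions of the
original one. -/
theorem isSolutionW_of_isSolutionUV (h : CouplingInverses A₁ A₂ C P₁ P₂ K) {u u' u'' : ℝ → H₁}
    {v v' v'' : ℝ → H₂} (hs : IsSolutionUV A₁ A₂ B C u u' u'' v v' v'') :
    IsSolutionW A₁ A₂ B C u u' u'' (fun t => -P₂ (v' t)) (fun t => -P₂ (v'' t))
      (fun t => K (app (sqrtOp A₁) (u' t)) + app (sqrtOp A₂) (v' t)) := by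
  have hS : ∀ z, app (sqrtOp A₂) (-P₂ z) = -z := fun z => by rw [← map_neg, h.inv₂.app_apply]
  have hmem : ∀ z, -P₂ z ∈ (sqrtOp A₂).domain := fun z => neg_mem (h.inv₂.apply_mem z)
  -- Since `v'` lies in `D(A₂^{1/2})`, `w₂` lies in `D(A₂)` with `A₂ w₂ = -A₂^{1/2} v'`.
  have hw : ∀ t : ℝ, 0 ≤ t →
      -P₂ (v' t) = P₂.comp P₂ (-app (sqrtOp A₂) (v' t)) := fun t ht => by
    rw [ContinuousLinearMap.comp_apply, map_neg, map_neg,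
      h.inv₂.apply_app (hs.traj₂.mem_deriv t ht)]
  refine ⟨hs.traj₁, ⟨fun t _ => hmem _, fun t _ => hmem _, ?_, ?_, ?_⟩, ?_, ?_, ?_⟩
  · exact hs.traj₂.c2.neg.congr (fun t _ => hS _) (fun t _ => hS _)
  · exact (hs.traj₂.c2.clm P₂).neg
  -- `v''` is only continuous; `-P₂ v''` is differentiable because it equals `C* u + A₂^{1/2} v`.
  · refine ((hs.traj₁.c1_domain.clm K).add hs.traj₂.c1_domain).congr (fun t ht => ?_)
      (fun t _ => rfl)
    rw [h.couple_eq_neg hs ht, h.app_adjoint (hs.traj₁.mem t ht)]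
  · intro t ht x hx
    have e := hs.eq₁ t ht x hx
    rw [← h.inner_adjoint (h.mem_adjoint hx) (h.mem_coupling (hmem _)), h.couple_eq_neg hs ht,
      inner_add_right]
    linear_combination e
  · intro t ht
    rw [hw t ht]
    exact h.sq₂.apply_mem _
  · intro t ht
    rw [hw t ht, h.sq₂.app_apply, h.app_adjoint (hs.traj₁.mem_deriv t ht)]
    abel

/-- `(w₁, w₂) ↦ (w₁, A₂^{-1/2} (w₂' - C* w₁))` maps solutions of the original system to solutions
of the transformed one. -/
theorem isSolutionUV_of_isSolutionW (h : CouplingInverses A₁ A₂ C P₁ P₂ K) {w₁ w₁' w₁'' : ℝ → H₁}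
    {w₂ w₂' w₂'' : ℝ → H₂} (hs : IsSolutionW A₁ A₂ B C w₁ w₁' w₁'' w₂ w₂' w₂'') :
    IsSolutionUV A₁ A₂ B C w₁ w₁' w₁'' (fun t => P₂ (w₂' t - K (app (sqrtOp A₁) (w₁ t))))
      (fun t => -app (sqrtOp A₂) (w₂ t)) (fun t => -app (sqrtOp A₂) (w₂' t)) := by
  -- The second equation of (a) is the derivative of `A₂^{1/2} v = w₂' - C* w₁`; it yields `v' =
  -- -A₂^{1/2} w₂`.
  have hA : ∀ t : ℝ, 0 ≤ t →
      w₂'' t - K (app (sqrtOp A₁) (w₁' t)) = -app A₂ (w₂ t) := fun t ht => by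
    rw [← h.app_adjoint (hs.traj₁.mem_deriv t ht), ← sub_eq_zero, ← hs.eq₂ t ht]
    abel
  have hw : ∀ t : ℝ, 0 ≤ t → app (sqrtOp A₂) (w₂ t) = P₂ (app A₂ (w₂ t)) := fun t ht =>
    (h.app_eq_sqrt_sqrt₂ (hs.mem₂ t ht)).2
  have hc := hs.traj₂.c2.sub (hs.traj₁.c1_domain.clm K)
  refine ⟨hs.traj₁, ⟨fun t _ => h.inv₂.apply_mem _, fun t ht => ?_, ?_, ?_, ?_⟩, ?_, ?_⟩
  · rw [hw t ht]
    exact neg_mem (h.inv₂.apply_mem _)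
  · refine hc.congr (fun t _ => h.inv₂.app_apply _) (fun t ht => ?_)
    rw [hA t ht, hw t ht, ← map_neg, h.inv₂.app_apply]
  · refine (hc.clm P₂).congr (fun t _ => rfl) (fun t ht => ?_)
    rw [hA t ht, hw t ht, map_neg]
  · exact hs.traj₂.c1_domain.neg
  · intro t ht x hx
    have e := hs.eq₁ t ht x hx
    rw [← h.inner_adjoint (h.mem_adjoint hx) (h.mem_coupling (hs.traj₂.mem_deriv t ht))] at e
    rw [h.inv₂.app_apply, ← h.app_adjoint (hs.traj₁.mem t ht), inner_sub_right]
    linear_combination e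
  · intro t ht y hy
    rw [h.inv₂.app_apply, ← h.app_adjoint (hs.traj₁.mem t ht), inner_sub_right, inner_neg_right,
      h.inner_sqrtOp_comm₂ hy (hs.traj₂.mem_deriv t ht)]
    ring

theorem expStableUV_of_expStableW (h : CouplingInverses A₁ A₂ C P₁ P₂ K)
    (hst : ExpStableW A₁ A₂ B C) : ExpStableUV A₁ A₂ B C := by
  obtain ⟨M, ω, hM, hω, hd⟩ := hst
  have hc : 0 < 3 + 3 * ‖K‖ ^ 2 := by positivity
  refine ⟨_, ω, mul_pos (mul_pos hc hM) hc, hω, fun u u' u'' v v' v'' hs => ?_⟩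
  refine exp_decay_of_comparable (e := energyCoupled A₁ A₂ C u u' v v') hM hc
    (fun t ht => h.energyUV_le _ _ _ _ _ (hs.traj₁.mem t ht)) (energyCoupled_le _ _ _ _ _)
    fun t ht => ?_
  have e : ∀ t : ℝ, 0 ≤ t → energyCoupled A₁ A₂ C u u' v v' t =
      energyW A₁ A₂ u u' (fun t => -P₂ (v' t)) (fun t => -P₂ (v'' t)) t := fun t ht => by
    rw [energyCoupled, energyW, ← h.couple_eq_neg hs ht, ← map_neg P₂ (v' t), h.inv₂.app_apply,
      norm_neg (v' t)]
    ring
  rw [e t ht, e 0 le_rfl]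
  exact hd _ _ _ _ _ _ (h.isSolutionW_of_isSolutionUV hs) t ht

theorem expStableW_of_expStableUV (h : CouplingInverses A₁ A₂ C P₁ P₂ K)
    (hst : ExpStableUV A₁ A₂ B C) : ExpStableW A₁ A₂ B C := by
  obtain ⟨M, ω, hM, hω, hd⟩ := hst
  have hc : 0 < 3 + 3 * ‖K‖ ^ 2 := by positivity
  refine ⟨_, ω, mul_pos (mul_pos hc hM) hc, hω, fun w₁ w₁' w₁'' w₂ w₂' w₂'' hs => ?_⟩
  have hs' := h.isSolutionUV_of_isSolutionW hs
  have e : ∀ t : ℝ, 0 ≤ t → energyW A₁ A₂ w₁ w₁' w₂ w₂' t = energyCoupled A₁ A₂ C w₁ w₁'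
      (fun t => P₂ (w₂' t - K (app (sqrtOp A₁) (w₁ t)))) (fun t => -app (sqrtOp A₂) (w₂ t)) t :=
    fun t ht => by
      rw [energyCoupled, energyW, h.inv₂.app_apply, h.app_adjoint (hs.traj₁.mem t ht),
        add_sub_cancel, norm_neg]
      ring
  refine exp_decay_of_comparable hM hc (fun t ht => ?_) ?_ (hd _ _ _ _ _ _ hs')
  · rw [e t ht]
    exact energyCoupled_le _ _ _ _ _
  · rw [e 0 le_rfl]
    exact h.energyUV_le _ _ _ _ _ (hs.traj₁.mem 0 le_rfl)

/-- The unitary `V` drops out of inner products, so the form of `A` is `⟪T p, T q⟫`. Test vectors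
`(x, 0)` and `(0, y)` split the equation into the two of (b), whose sum gives it back. -/
theorem isSolutionAbstract_iff (h : CouplingInverses A₁ A₂ C P₁ P₂ K)
    {W W' W'' : ℝ → WithLp 2 (H₁ × H₂)} :
    IsSolutionAbstract A₁ A₂ B C W W' W'' ↔
      IsSolutionUV A₁ A₂ B C (fun t => (W t).fst) (fun t => (W' t).fst) (fun t => (W'' t).fst)
        (fun t => (W t).snd) (fun t => (W' t).snd) (fun t => (W'' t).snd) := by
  obtain ⟨V, hV⟩ := h.exists_sqrtOp_matrixOp
  have hcpl : ∀ p : WithLp 2 (H₁ × H₂), p.fst ∈ (sqrtOp A₁).domain →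
      couple A₂ C p = K (app (sqrtOp A₁) p.fst) + app (sqrtOp A₂) p.snd := fun p hp => by
    rw [couple, h.app_adjoint hp]
  have hinner : ∀ p q : WithLp 2 (H₁ × H₂), p ∈ (sqrtOp (matrixOp A₁ A₂ C)).domain →
      q ∈ (sqrtOp (matrixOp A₁ A₂ C)).domain →
      ⟪app (sqrtOp (matrixOp A₁ A₂ C)) p, app (sqrtOp (matrixOp A₁ A₂ C)) q⟫_𝕜 =
        ⟪app (sqrtOp A₁) p.fst, app (sqrtOp A₁) q.fst⟫_𝕜
          + ⟪app C.adjoint p.fst + app (sqrtOp A₂) p.snd,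
              app C.adjoint q.fst + app (sqrtOp A₂) q.snd⟫_𝕜 := fun p q hp hq => by
    rw [(hV p).2 hp, (hV q).2 hq, LinearIsometryEquiv.inner_map_map, WithLp.prod_inner_apply]
    rfl
  constructor
  · intro hs
    have hm := fun t ht => (hV (W t)).1.1 (hs.traj.mem t ht)
    have hm' := fun t ht => (hV (W' t)).1.1 (hs.traj.mem_deriv t ht)
    have hc : IsC1 𝕜 (fun t => WithLp.toLp 2 (app (sqrtOp A₁) (W t).fst, couple A₂ C (W t)))
        (fun t => WithLp.toLp 2 (app (sqrtOp A₁) (W' t).fst, couple A₂ C (W' t))) := by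
      refine (hs.traj.c1_domain.clm
        (V.symm.toContinuousLinearEquiv : _ →L[𝕜] WithLp 2 (H₁ × H₂))).congr
        (fun t ht => ?_) (fun t ht => ?_)
      · rw [(hV _).2 (hs.traj.mem t ht)]
        exact (V.symm_apply_apply _).symm
      · rw [(hV _).2 (hs.traj.mem_deriv t ht)]
        exact (V.symm_apply_apply _).symm
    refine ⟨⟨fun t ht => (hm t ht).1, fun t ht => (hm' t ht).1, hc.fst, hs.traj.c1.fst,
        hs.traj.c2.fst⟩, ⟨fun t ht => (hm t ht).2, fun t ht => (hm' t ht).2, ?_, hs.traj.c1.snd,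
        hs.traj.c2.snd⟩, fun t ht x hx => ?_, fun t ht y hy => ?_⟩
    -- `A₂^{1/2} v` is the second component of `T W` minus `K` applied to the first.
    · refine (hc.snd.sub (hc.fst.clm K)).congr (fun t ht => ?_) (fun t ht => ?_)
      · simp only [WithLp.toLp_fst, WithLp.toLp_snd]
        rw [hcpl _ (hm t ht).1, add_sub_cancel_left]
      · simp only [WithLp.toLp_fst, WithLp.toLp_snd]
        rw [hcpl _ (hm' t ht).1, add_sub_cancel_left]
    · have hZ : WithLp.toLp 2 (x, (0 : H₂)) ∈ (sqrtOp (matrixOp A₁ A₂ C)).domain :=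
        (hV _).1.2 ⟨hx, Submodule.zero_mem _⟩
      have e := hs.eq t ht _ hZ
      rw [hinner _ _ hZ (hs.traj.mem t ht), WithLp.prod_inner_apply] at e
      simp only [WithLp.ofLp_fst, WithLp.ofLp_snd, WithLp.toLp_fst, WithLp.toLp_snd, app_zero,
        inner_zero_left, add_zero, inner_add_right] at e
      linear_combination e
    · have hZ : WithLp.toLp 2 ((0 : H₁), y) ∈ (sqrtOp (matrixOp A₁ A₂ C)).domain :=
        (hV _).1.2 ⟨Submodule.zero_mem _, hy⟩
      have e := hs.eq t ht _ hZ
      rw [hinner _ _ hZ (hs.traj.mem t ht), WithLp.prod_inner_apply] at e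
      simp only [WithLp.ofLp_fst, WithLp.ofLp_snd, WithLp.toLp_fst, WithLp.toLp_snd, app_zero,
        inner_zero_left, add_zero, zero_add, inner_add_right, ControlOperator.pair_zero] at e
      linear_combination e
  · intro hs
    have hm : ∀ t : ℝ, 0 ≤ t → W t ∈ (sqrtOp (matrixOp A₁ A₂ C)).domain := fun t ht =>
      (hV _).1.2 ⟨hs.traj₁.mem t ht, hs.traj₂.mem t ht⟩
    have hm' : ∀ t : ℝ, 0 ≤ t → W' t ∈ (sqrtOp (matrixOp A₁ A₂ C)).domain := fun t ht =>
      (hV _).1.2 ⟨hs.traj₁.mem_deriv t ht, hs.traj₂.mem_deriv t ht⟩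
    refine ⟨⟨hm, hm', ?_, hs.traj₁.c1.toLp_prod hs.traj₂.c1, hs.traj₁.c2.toLp_prod hs.traj₂.c2⟩,
      fun t ht Z hZ => ?_⟩
    · refine ((hs.traj₁.c1_domain.toLp_prod
        ((hs.traj₁.c1_domain.clm K).add hs.traj₂.c1_domain)).clm
        (V.toContinuousLinearEquiv : _ →L[𝕜] WithLp 2 (H₁ × H₂))).congr
        (fun t ht => ?_) (fun t ht => ?_)
      · rw [(hV _).2 (hm t ht), hcpl _ (hs.traj₁.mem t ht)]
        rfl
      · rw [(hV _).2 (hm' t ht), hcpl _ (hs.traj₁.mem_deriv t ht)]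
        rfl
    · obtain ⟨hx, hy⟩ := (hV Z).1.1 hZ
      have e₁ := hs.eq₁ t ht _ hx
      have e₂ := hs.eq₂ t ht _ hy
      rw [hinner _ _ hZ (hm t ht), WithLp.prod_inner_apply]
      simp only [WithLp.ofLp_fst, WithLp.ofLp_snd, inner_add_left, inner_add_right]
      linear_combination e₁ + e₂

theorem energyAbstract_eq (h : CouplingInverses A₁ A₂ C P₁ P₂ K)
    {W W' : ℝ → WithLp 2 (H₁ × H₂)} {t : ℝ} (h₁ : (W t).fst ∈ (sqrtOp A₁).domain)
    (h₂ : (W t).snd ∈ (sqrtOp A₂).domain) :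
    energyAbstract A₁ A₂ C W W' t = energyCoupled A₁ A₂ C (fun t => (W t).fst)
      (fun t => (W' t).fst) (fun t => (W t).snd) (fun t => (W' t).snd) t := by
  obtain ⟨V, hV⟩ := h.exists_sqrtOp_matrixOp
  rw [energyAbstract, energyCoupled, (hV _).2 ((hV _).1.2 ⟨h₁, h₂⟩), LinearIsometryEquiv.norm_map,
    WithLp.prod_norm_sq_eq_of_L2, WithLp.prod_norm_sq_eq_of_L2]
  rfl

theorem expStableAbstract_of_expStableUV (h : CouplingInverses A₁ A₂ C P₁ P₂ K)
    (hst : ExpStableUV A₁ A₂ B C) : ExpStableAbstract A₁ A₂ B C := by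
  obtain ⟨M, ω, hM, hω, hd⟩ := hst
  have hc : 0 < 3 + 3 * ‖K‖ ^ 2 := by positivity
  refine ⟨_, ω, mul_pos (mul_pos hc hM) hc, hω, fun W W' W'' hs => ?_⟩
  have hs' := h.isSolutionAbstract_iff.1 hs
  have e : ∀ t : ℝ, 0 ≤ t → _ := fun t ht =>
    h.energyAbstract_eq (W' := W') (hs'.traj₁.mem t ht) (hs'.traj₂.mem t ht)
  refine exp_decay_of_comparable hM hc (fun t ht => ?_) ?_ (hd _ _ _ _ _ _ hs')
  · rw [e t ht]
    exact energyCoupled_le _ _ _ _ _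
  · rw [e 0 le_rfl]
    exact h.energyUV_le _ _ _ _ _ (hs'.traj₁.mem 0 le_rfl)

theorem expStableUV_of_expStableAbstract (h : CouplingInverses A₁ A₂ C P₁ P₂ K)
    (hst : ExpStableAbstract A₁ A₂ B C) : ExpStableUV A₁ A₂ B C := by
  obtain ⟨M, ω, hM, hω, hd⟩ := hst
  have hc : 0 < 3 + 3 * ‖K‖ ^ 2 := by positivity
  refine ⟨_, ω, mul_pos (mul_pos hc hM) hc, hω, fun u u' u'' v v' v'' hs => ?_⟩
  have hs' : IsSolutionAbstract A₁ A₂ B C (fun t => WithLp.toLp 2 (u t, v t))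
      (fun t => WithLp.toLp 2 (u' t, v' t)) (fun t => WithLp.toLp 2 (u'' t, v'' t)) :=
    h.isSolutionAbstract_iff.2 hs
  have e : ∀ t : ℝ, 0 ≤ t → energyAbstract A₁ A₂ C (fun t => WithLp.toLp 2 (u t, v t))
      (fun t => WithLp.toLp 2 (u' t, v' t)) t = energyCoupled A₁ A₂ C u u' v v' t := fun t ht =>
    h.energyAbstract_eq (W := fun t => WithLp.toLp 2 (u t, v t))
      (W' := fun t => WithLp.toLp 2 (u' t, v' t)) (hs.traj₁.mem t ht) (hs.traj₂.mem t ht)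
  refine exp_decay_of_comparable hM hc (fun t ht => ?_) ?_ (hd _ _ _ hs')
  · rw [e t ht]
    exact h.energyUV_le _ _ _ _ _ (hs.traj₁.mem t ht)
  · rw [e 0 le_rfl]
    exact energyCoupled_le _ _ _ _ _

end CouplingInverses

end Equivalence

end CoupledSystem

theorem corollary3p3 {𝕜 H₁ H₂ U : Type*} [RCLike 𝕜]
    [NormedAddCommGroup H₁] [InnerProductSpace 𝕜 H₁] [CompleteSpace H₁]
    [NormedAddCommGroup H₂] [InnerProductSpace 𝕜 H₂] [CompleteSpace H₂]
    [NormedAddCommGroup U] [InnerProductSpace 𝕜 U] [CompleteSpace U]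
    (A₁ : H₁ →ₗ.[𝕜] H₁) (A₂ : H₂ →ₗ.[𝕜] H₂)
    (hA₁ : CoupledSystem.IsPositiveSelfAdjoint A₁)
    (hA₂ : CoupledSystem.IsPositiveSelfAdjoint A₂)
    (B : CoupledSystem.ControlOperator (CoupledSystem.sqrtOp A₁) U)
    (C : H₂ →ₗ.[𝕜] H₁)
    (hCadj : CoupledSystem.DomainEmbeds (CoupledSystem.sqrtOp A₁) C.adjoint)
    (hC : CoupledSystem.DomainEmbeds (CoupledSystem.sqrtOp A₂) C)
    (hcond : ∃ δ : ℝ, 0 ≤ δ ∧ δ < 1 / 2 ∧ ∀ x ∈ A₁.domain, ∀ y ∈ A₂.domain,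
      ‖⟪x, CoupledSystem.app C y⟫_𝕜‖ ≤
        δ * (‖CoupledSystem.app (CoupledSystem.sqrtOp A₁) x‖ ^ 2 + ‖y‖ ^ 2
          + ‖CoupledSystem.app C.adjoint x‖ ^ 2)) :
    List.TFAE [CoupledSystem.ExpStableW A₁ A₂ B C,
      CoupledSystem.ExpStableUV A₁ A₂ B C,
      CoupledSystem.ExpStableAbstract A₁ A₂ B C] := by
  obtain ⟨P₁, P₂, K, h⟩ := CoupledSystem.exists_couplingInverses hA₁ hA₂ hCadj hC
  tfae_have 1 → 2 := h.expStableUV_of_expStableW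
  tfae_have 2 → 1 := h.expStableW_of_expStableUV
  tfae_have 2 → 3 := h.expStableAbstract_of_expStableUV
  tfae_have 3 → 2 := h.expStableUV_of_expStableAbstract
  tfae_finish
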